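/- **Setting.** Let $N,M\ge 1$. For $k\ge1$ and $x\in\mathbb C^N$ put $p_k(x)=k^{-1/2}\sum_{n=1}^N x_n^k$, and for a square-summable sequence $h=(h_k)_{k\ge1}$ write $\langle h,p(x)\rangle=\sum_{k\ge1}h_kp_k(x)$. Let $V$ be the law of the eigenvalues of a Haar-distributed $N\times N$ unitary matrix, i.e. the probability measure on $N$ copies of the unit circle with density $\frac1{N!}\prod_{i<j}|x_i-x_j|^2$ with respect to the uniform measure. *Teacher.* $F(x)=f(\langle h^*,p(x)\rangle)$, where $h^*\in\ell^2$ has norm $1$ and $h^*_k=0$ for $k>\sqrt N$, and $f(z)=\sum_{1\le j\le\sqrt N}\frac{\alpha_j}{\sqrt{j!}}z^j$ is not identically zero, with $\alpha_j\in\mathbb C$. Let $s=\min\{j\ge1:\alpha_j\ne0\}$ be its information exponent. *Student.* Let $\sigma(z)=\sum_{k\ge1}c_kz^k$, with the series converging (unconditionally) for $|z|\le1$ and $\sum_k k|c_k|^2<\infty$. Let $a_1,\dots,a_M$ be points of the unit circle, $\Phi_m(x)=\sum_{n=1}^N\sigma(a_mx_n)$, $g(z)=\frac{\alpha_s}{|\alpha_s|\sqrt{s!}}z^s$,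 and $F_w(x)=g\big(\sum_m w_m\Phi_m(x)\big)$ for $w\in\mathbb C^M$. Let $A:\mathbb C^M\to\ell^2$ be the matrix $A_{km}=c_k\sqrt k\,a_m^k$, so that $\sum_m w_m\Phi_m(x)=\langle Aw,p(x)\rangle$ for $x$ on the torus. Assume that $A^\dagger A$ is invertible. *Flow.* Let $$L(w)=\mathbb E_{x\sim V}\big[-\operatorname{Re}\big(F(x)\overline{F_w(x)}\big)\big]+\tfrac{|\alpha_s|}2\|Aw\|^{2s},$$ and let $\nabla L=\nabla_{w_R}L+i\nabla_{w_C}L$, where $w=w_R+iw_C$. Let $w_t$, $t\ge0$, be a solution of the preconditioned gradient flow $$\dot w=-\frac1{s|\alpha_s|}(A^\dagger A)^{-1}\nabla L(w).$$ Along it, with $\langle\cdot,\cdot\rangle$ linear in the first argument, write $\langle Aw_t,h^*\rangle=r_te^{i\theta_t}$ in polar form and $v_t=\|P_{h^*}^\perp Aw_t\|^2$, where $P_{h^*}^\perp$ is the orthogonal projection onto the orthogonal complement of $h^*$. Let $\delta=1-\|P_Ah^*\|^2$, where $P_A$ is the orthogonal projection onto the range of $A$. **Theorem.** There are universal constants $c,C>0$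 such that the following holds in every such setting. Let $\epsilon>0$ and suppose that 1. $0<r_0\le1$; 2. $\cos s\theta_0\ge\frac12$; 3. $v_0=1-r_0^2$; 4. $\delta\le\min\big(\epsilon/2,\;c\,s^{-s}r_0^4\big)$. Then there is a time $T\ge0$ with $$r_T\ge1-\epsilon,\qquad\cos s\theta_T\ge1-\epsilon,\qquad v_T\le\epsilon,$$ and $$T\le\begin{cases}C\log^+\frac1\epsilon,&s=1,\\[2pt] C\big(2^{s^2}r_0^{-4s}+\log^+\frac1\epsilon\big),&s>1,\end{cases}$$ where $\log^+y=\max(0,\log y)$. -/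

import Mathlib

open MeasureTheory

noncomputable section

namespace DeepSets

/-! ### Power sums and the input distribution -/

/-- The feature space `ℂ^∞`: square-summable complex sequences indexed by `k = 1, 2, …`. -/
abbrev Feature : Type := lp (fun _ : ℕ+ => ℂ) 2

/-- The normalized power sum `p_k(x) = k^{-1/2} ∑ₙ xₙ^k`. -/
def powerSum {N : ℕ} (k : ℕ+) (x : Fin N → ℂ) : ℂ :=
  ((1 / Real.sqrt (k : ℕ) : ℝ) : ℂ) * ∑ n, x n ^ (k : ℕ)

/-- The pairing `⟨h, p(x)⟩ = ∑_{k ≥ 1} h_k p_k(x)`. -/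
def pairing {N : ℕ} (h : Feature) (x : Fin N → ℂ) : ℂ :=
  ∑' k : ℕ+, h k * powerSum k x

/-- The uniform probability measure on the complex unit circle. -/
def unitCircleMeasure : Measure ℂ :=
  (AddCircle.haarAddCircle (T := (1 : ℝ))).map (fun θ => (AddCircle.toCircle θ : ℂ))

/-- The law of the eigenvalues of a Haar distributed `N × N` unitary matrix: the measure on `N`
copies of the unit circle with density `(1 / N!) ∏_{i < j} |x_i - x_j|²` with respect to the
uniform distribution. -/
def vandermondeMeasure (N : ℕ) : Measure (Fin N → ℂ) :=
  (Measure.pi (fun _ : Fin N => unitCircleMeasure)).withDensity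
    (fun x => ENNReal.ofReal
      ((1 / (N.factorial : ℝ)) * ∏ i : Fin N, ∏ j ∈ Finset.Ioi i, ‖x i - x j‖ ^ 2))

/-! ### Teacher -/

/-- The link function `f(z) = ∑_{1 ≤ j ≤ √N} α_j / √(j!) z^j`. -/
def link (N : ℕ) (α : ℕ → ℂ) (z : ℂ) : ℂ :=
  ∑ j ∈ Finset.Icc 1 (Nat.sqrt N), α j / ((Real.sqrt (j.factorial) : ℝ) : ℂ) * z ^ j

/-- The teacher `F(x) = f(⟨h*, p(x)⟩)`. -/
def teacher {N : ℕ} (α : ℕ → ℂ) (h : Feature) (x : Fin N → ℂ) : ℂ :=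
  link N α (pairing h x)

/-- `s` is the information exponent `min {j ≥ 1 : α_j ≠ 0}` of the link function `link N α`. -/
def IsInfoExponent (N : ℕ) (α : ℕ → ℂ) (s : ℕ) : Prop :=
  IsLeast {j : ℕ | j ∈ Finset.Icc 1 (Nat.sqrt N) ∧ α j ≠ 0} s

/-! ### Student -/

/-- An analytic activation `σ(z) = ∑_{k ≥ 1} c_k z^k`, without constant term, whose power series
converges on the closed unit disk and satisfies `∑ k |c_k|² < ∞`. -/
structure Activation where
  /-- the function `σ` -/
  toFun : ℂ → ℂ
  /-- the Taylor coefficients `c_k` -/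
  coeff : ℕ+ → ℂ
  hasSum : ∀ z : ℂ, ‖z‖ ≤ 1 → HasSum (fun k : ℕ+ => coeff k * z ^ (k : ℕ)) (toFun z)
  summable : Summable (fun k : ℕ+ => ((k : ℕ) : ℝ) * ‖coeff k‖ ^ 2)

/-- The symmetric embedding `Φ_m(x) = ∑ₙ σ(a_m xₙ)` with frozen weights `a`. -/
def embedding {N M : ℕ} (σ : Activation) (a : Fin M → Circle) (x : Fin N → ℂ) (m : Fin M) : ℂ :=
  ∑ n, σ.toFun ((a m : ℂ) * x n)

/-- The student link function `g(z) = α_s / (|α_s| √(s!)) z^s`. -/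
def studentLink (α : ℕ → ℂ) (s : ℕ) (z : ℂ) : ℂ :=
  α s / ((‖α s‖ * Real.sqrt (s.factorial) : ℝ) : ℂ) * z ^ s

/-- The DeepSets student network `F_w(x) = g(⟨w, Φ(x)⟩)` with trainable weights `w`. -/
def student {N M : ℕ} (σ : Activation) (a : Fin M → Circle) (α : ℕ → ℂ) (s : ℕ)
    (w : EuclideanSpace ℂ (Fin M)) (x : Fin N → ℂ) : ℂ :=
  studentLink α s (∑ m, w m * embedding σ a x m)

theorem memlp_column (σ : Activation) (a : Circle) :
    Memℓp (fun k : ℕ+ => σ.coeff k * ((Real.sqrt (k : ℕ) : ℝ) : ℂ) * (a : ℂ) ^ (k : ℕ)) 2 := by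
  refine memℓp_gen (σ.summable.congr fun k => ?_)
  have h1 : ‖(a : ℂ)‖ = 1 := Circle.norm_coe a
  simp [h1, mul_pow, mul_comm]

/-- The `m`-th column of `A`, with entries `A_{km} = c_k √k a_m^k`. -/
def column (σ : Activation) (a : Circle) : Feature :=
  ⟨fun k : ℕ+ => σ.coeff k * ((Real.sqrt (k : ℕ) : ℝ) : ℂ) * (a : ℂ) ^ (k : ℕ),
    memlp_column σ a⟩

/-- The matrix `A ∈ ℂ^{∞ × M}` as the operator `w ↦ ∑ₘ w_m A_{·m}`. -/
def featureMap {M : ℕ} (σ : Activation) (a : Fin M → Circle) :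
    EuclideanSpace ℂ (Fin M) →L[ℂ] Feature :=
  ∑ m, (EuclideanSpace.proj m : EuclideanSpace ℂ (Fin M) →L[ℂ] ℂ).smulRight (column σ (a m))

/-- `A† A`. -/
def gram {M : ℕ} (σ : Activation) (a : Fin M → Circle) :
    EuclideanSpace ℂ (Fin M) →L[ℂ] EuclideanSpace ℂ (Fin M) :=
  (ContinuousLinearMap.adjoint (featureMap σ a)).comp (featureMap σ a)

/-- On the torus, the network pre-activation `⟨w, Φ(x)⟩` equals `⟨A w, p(x)⟩`. -/
theorem sum_embedding_eq_pairing {N M : ℕ} (σ : Activation) (a : Fin M → Circle)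
    (w : EuclideanSpace ℂ (Fin M)) (x : Fin N → ℂ) (hx : ∀ n, ‖x n‖ = 1) :
    ∑ m, w m * embedding σ a x m = pairing (featureMap σ a w) x := by
  have h1 : HasSum (fun k : ℕ+ => ∑ m, w m * ∑ n, σ.coeff k * ((a m : ℂ) * x n) ^ (k : ℕ))
      (∑ m, w m * embedding σ a x m) := by
    refine hasSum_sum fun m _ => HasSum.mul_left _ (hasSum_sum fun n _ => σ.hasSum _ ?_)
    have h0 : ‖(a m : ℂ)‖ = 1 := Circle.norm_coe (a m)
    simp [h0, hx]
  rw [← h1.tsum_eq, pairing]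
  refine tsum_congr fun k => ?_
  have hk : ((Real.sqrt (k : ℕ) : ℝ) : ℂ) ≠ 0 := by
    have : (0 : ℝ) < (k : ℕ) := by exact_mod_cast k.pos
    exact_mod_cast (Real.sqrt_pos.2 this).ne'
  have h2 : (featureMap σ a w) k
      = ∑ m, w m * (σ.coeff k * ((Real.sqrt (k : ℕ) : ℝ) : ℂ) * (a m : ℂ) ^ (k : ℕ)) := by
    simp only [featureMap, _root_.sum_apply, lp.coeFn_sum]
    exact Finset.sum_apply k Finset.univ _
  rw [h2, powerSum, Finset.sum_mul]
  refine Finset.sum_congr rfl fun m _ => ?_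
  simp only [mul_pow, ← Finset.mul_sum]
  push_cast
  field_simp

/-! ### Loss and preconditioned gradient flow -/

/-- The correlational loss
`L(w) = 𝔼_{x ∼ V}[-Re (F(x) conj(F_w(x)))] + |α_s| / 2 ‖A w‖^{2s}`. -/
def loss {M : ℕ} (N : ℕ) (σ : Activation) (a : Fin M → Circle) (α : ℕ → ℂ) (s : ℕ) (h : Feature)
    (w : EuclideanSpace ℂ (Fin M)) : ℝ :=
  (∫ x : Fin N → ℂ, -(teacher α h x * (starRingEnd ℂ) (student σ a α s w x)).re
      ∂(vandermondeMeasure N))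
    + ‖α s‖ / 2 * ‖featureMap σ a w‖ ^ (2 * s)

/-- The gradient `∇L = ∇_{w_R} L + i ∇_{w_C} L` of a real function of `w = w_R + i w_C`. -/
def complexGrad {M : ℕ} (L : EuclideanSpace ℂ (Fin M) → ℝ) (w : EuclideanSpace ℂ (Fin M)) :
    EuclideanSpace ℂ (Fin M) :=
  WithLp.toLp 2 fun m =>
    ((deriv (fun t : ℝ => L (w + EuclideanSpace.single m (t : ℂ))) 0 : ℝ) : ℂ)
      + Complex.I *
        ((deriv (fun t : ℝ => L (w + EuclideanSpace.single m (Complex.I * (t : ℂ)))) 0 : ℝ) : ℂ)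

/-- `w : [0, ∞) → ℂ^M` solves `ẇ = -(1 / (s |α_s|)) (A† A)⁻¹ ∇L(w)`. -/
def IsPreconditionedFlow {M : ℕ} (N : ℕ) (σ : Activation) (a : Fin M → Circle) (α : ℕ → ℂ)
    (s : ℕ) (h : Feature) (w : ℝ → EuclideanSpace ℂ (Fin M)) : Prop :=
  ∀ t : ℝ, 0 ≤ t → HasDerivWithinAt w
    (-((1 / (s * ‖α s‖) : ℝ) • (gram σ a).inverse (complexGrad (loss N σ a α s h) (w t))))
    (Set.Ici 0) t

/-! ### Summary statistics -/

/-- `m = ⟨A w, h*⟩`, linear in `w`. -/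
def overlap {M : ℕ} (σ : Activation) (a : Fin M → Circle) (h : Feature)
    (w : EuclideanSpace ℂ (Fin M)) : ℂ :=
  inner ℂ h (featureMap σ a w)

/-- `r = |m|`, the modulus in the polar decomposition `m = r e^{iθ}`. -/
def radius {M : ℕ} (σ : Activation) (a : Fin M → Circle) (h : Feature)
    (w : EuclideanSpace ℂ (Fin M)) : ℝ :=
  ‖overlap σ a h w‖

/-- `cos (s θ)`, where `θ` is the argument of `m`. -/
def cosPhase {M : ℕ} (σ : Activation) (a : Fin M → Circle) (s : ℕ) (h : Feature)
    (w : EuclideanSpace ℂ (Fin M)) : ℝ :=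
  Real.cos (s * Complex.arg (overlap σ a h w))

/-- `v = ‖P_{h*}^⊥ A w‖²`. -/
def residual {M : ℕ} (σ : Activation) (a : Fin M → Circle) (h : Feature)
    (w : EuclideanSpace ℂ (Fin M)) : ℝ :=
  ‖((Submodule.span ℂ {h})ᗮ).starProjection (featureMap σ a w)‖ ^ 2

/-- `δ = 1 - ‖P_A h*‖²`, with `P_A` the orthogonal projection onto the range of `A`. -/
def approxError {M : ℕ} (σ : Activation) (a : Fin M → Circle) (h : Feature) : ℝ :=
  1 - ‖((featureMap σ a : EuclideanSpace ℂ (Fin M) →ₗ[ℂ] Feature).range).starProjection h‖ ^ 2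

end DeepSets

end

noncomputable section

namespace DeepSets

open Set

/-! ### Differential inequalities on the half-line -/

section Comparison

variable {f f' : ℝ → ℝ}

/-! The proof has two independent halves: an exact formula for the population loss, and an analysis
of the closed system of ODEs that it produces.

Loss. Under the Vandermonde law the power sums have the moments of independent complex Gaussians as
long as one of the two paired polynomials has degree at most `N`; the other may have any degree. The
teacher has degree at most `√N · √N ≤ N`, so only its degree-`s` term correlates with the student,
and `loss_eq` gives `L = |α_s| (-Re m^s + ‖Aw‖^{2s} / 2)` with `m = ⟨Aw, h*⟩`. The Gaussian moments
follow from `psumPair_X_mul`: multiplication by `p_k` is adjoint to `k ∂/∂p_k`. Its proof integrates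
by parts against the Vandermonde weight (`vandermondeMean_loop`) and shows that, in each degree `d ≤
N`, the largest failure of adjointness is at most `(d - 1) / N` times itself.

Dynamics. Preconditioning cancels the Gram matrix, so `n = |m|²`, `ρ = ‖Aw‖²`, `x = Re m^s` and `y =
Im m^s` obey a closed system with the single parameter `D = 1 - δ` (`reducedFlow`). The damping
drops out of two quotients: `(y/x)²` is nonincreasing, and `n/ρ` relaxes to `D` at rate `2x/ρ`. They
give a uniform lower bound on `x` (`x_lower_bound`), and with it the time of order `s 4^s r₀^{-2s}`
after which `n/ρ` is close to `D` and `ρ^s` is bounded below. From then on phase, direction and norm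
converge exponentially (`target_of_two_le`). For `s = 1` the equations of `x` and `y` are linear and
decoupled, and there is no slow stage (`target_of_eq_one`). -/

theorem le_of_deriv_nonneg_Ioo (hf : ∀ t, 0 ≤ t → HasDerivWithinAt f (f' t) (Ici 0) t)
    {a b : ℝ} (ha : 0 ≤ a) (hab : a ≤ b) (h : ∀ t ∈ Ioo a b, 0 ≤ f' t) : f a ≤ f b := by
  have hsub : Icc a b ⊆ Ici 0 := fun t ht => ha.trans ht.1
  have hmono : MonotoneOn f (Icc a b) := by
    refine monotoneOn_of_hasDerivWithinAt_nonneg (f' := f') (convex_Icc a b)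
      (fun t ht => ((hf t (hsub ht)).continuousWithinAt).mono hsub) ?_ ?_
    · intro t ht
      rw [interior_Icc] at ht ⊢
      exact (hf t (ha.trans ht.1.le)).mono (Ioo_subset_Icc_self.trans hsub)
    · intro t ht
      rw [interior_Icc] at ht
      exact h t ht
  exact hmono (left_mem_Icc.2 hab) (right_mem_Icc.2 hab) hab

/-- A lower barrier: if `f` is nondecreasing whenever it is below `K`, it never falls below `K`. -/
theorem barrier_le (hf : ∀ t, 0 ≤ t → HasDerivWithinAt f (f' t) (Ici 0) t)
    {K a b : ℝ} (ha : 0 ≤ a) (hab : a ≤ b) (h0 : K ≤ f a)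
    (h : ∀ t, a ≤ t → f t < K → 0 ≤ f' t) : K ≤ f b := by
  by_contra! hb
  have hsub : Icc a b ⊆ Ici 0 := fun t ht => ha.trans ht.1
  have hcont : ContinuousOn f (Icc a b) :=
    fun t ht => ((hf t (hsub ht)).continuousWithinAt).mono hsub
  have hclosed : IsClosed {t ∈ Icc a b | K ≤ f t} :=
    (isClosed_Icc : IsClosed (Icc a b)).isClosed_le continuousOn_const hcont
  have hne : ({t ∈ Icc a b | K ≤ f t}).Nonempty := ⟨a, left_mem_Icc.2 hab, h0⟩
  have hbdd : BddAbove {t ∈ Icc a b | K ≤ f t} := ⟨b, fun t ht => ht.1.2⟩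
  set t0 := sSup {t ∈ Icc a b | K ≤ f t}
  have ht0 : t0 ∈ {t ∈ Icc a b | K ≤ f t} := hclosed.csSup_mem hne hbdd
  have hle : f t0 ≤ f b := by
    refine le_of_deriv_nonneg_Ioo hf (hsub ht0.1) ht0.1.2 fun t ht => ?_
    refine h t (ht0.1.1.trans ht.1.le) ?_
    by_contra! hK
    exact (le_csSup hbdd ⟨⟨ht0.1.1.trans ht.1.le, ht.2.le⟩, hK⟩).not_gt ht.1
  exact (ht0.2.trans hle).not_gt hb

/-- If `f` grows at rate at least `κ` whenever it is below `K`, it is above `K` from time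
`a + (K - f a) / κ` on. -/
theorem reach_le (hf : ∀ t, 0 ≤ t → HasDerivWithinAt f (f' t) (Ici 0) t)
    {K κ a b : ℝ} (ha : 0 ≤ a) (hab : a ≤ b) (hκ : 0 ≤ κ) (hb : K - f a ≤ κ * (b - a))
    (h : ∀ t, a ≤ t → f t < K → κ ≤ f' t) : K ≤ f b := by
  by_contra! hlt
  have hbelow : ∀ t ∈ Icc a b, f t < K := by
    intro t ht
    by_contra! hK
    exact (barrier_le hf (ha.trans ht.1) ht.2 hK
      fun u hu hfu => hκ.trans (h u (ht.1.trans hu) hfu)).not_gt hlt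
  have hg : ∀ t, 0 ≤ t → HasDerivWithinAt (fun t => f t - κ * t) (f' t - κ) (Ici 0) t := by
    intro t ht
    have h1 : HasDerivWithinAt (fun t : ℝ => κ * t) κ (Ici 0) t := by
      simpa using (hasDerivWithinAt_id t (Ici 0)).const_mul κ
    exact (hf t ht).sub h1
  have := le_of_deriv_nonneg_Ioo hg ha hab
    fun t ht => sub_nonneg.2 (h t ht.1.le (hbelow t ⟨ht.1.le, ht.2.le⟩))
  linarith

/-- Grönwall: `f t * exp (κ t)` is nonincreasing. No sign of `f` or `κ` is assumed, so `f = -x`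
turns it into a lower bound for `x`. -/
theorem exp_decay_le (hf : ∀ t, 0 ≤ t → HasDerivWithinAt f (f' t) (Ici 0) t)
    {κ a b : ℝ} (ha : 0 ≤ a) (hab : a ≤ b) (h : ∀ t ∈ Ioo a b, f' t ≤ -κ * f t) :
    f b ≤ f a * Real.exp (-κ * (b - a)) := by
  have hg : ∀ t, 0 ≤ t → HasDerivWithinAt (fun t => -(f t * Real.exp (κ * t)))
      (-(f' t * Real.exp (κ * t) + f t * (Real.exp (κ * t) * κ))) (Ici 0) t := by
    intro t ht
    have h1 : HasDerivWithinAt (fun t : ℝ => Real.exp (κ * t)) (Real.exp (κ * t) * κ) (Ici 0) t := by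
      simpa using ((hasDerivWithinAt_id t (Ici 0)).const_mul κ).exp
    exact ((hf t ht).mul h1).neg
  have := le_of_deriv_nonneg_Ioo hg ha hab fun t ht => by
    have h1 := h t ht
    have h2 := Real.exp_pos (κ * t)
    nlinarith
  simp only [neg_le_neg_iff] at this
  have he : Real.exp (-κ * (b - a)) = Real.exp (κ * a) * (Real.exp (κ * b))⁻¹ := by
    rw [← Real.exp_neg, ← Real.exp_add]; congr 1; ring
  rw [he, ← mul_assoc, ← div_eq_mul_inv, le_div_iff₀ (Real.exp_pos _)]
  exact this

end Comparison

/-! ### The reduced dynamics -/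

/-- The closed system satisfied by `n = |m|²`, `ρ = ‖A w‖²`, `x = Re m^s` and `y = Im m^s` along the
flow, where `m` is the overlap and `D = 1 - δ`. -/
structure ReducedFlow (s : ℕ) (D : ℝ) (n ρ x y : ℝ → ℝ) : Prop where
  hs : 1 ≤ s
  hD0 : 0 ≤ D
  hD1 : D ≤ 1
  deriv_n : ∀ t, 0 ≤ t →
    HasDerivWithinAt n (2 * (D * x t - ρ t ^ (s - 1) * n t)) (Ici 0) t
  deriv_ρ : ∀ t, 0 ≤ t → HasDerivWithinAt ρ (2 * (x t - ρ t ^ s)) (Ici 0) t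
  deriv_x : ∀ t, 0 ≤ t →
    HasDerivWithinAt x (s * (D * n t ^ (s - 1) - ρ t ^ (s - 1) * x t)) (Ici 0) t
  deriv_y : ∀ t, 0 ≤ t → HasDerivWithinAt y (-(s * (ρ t ^ (s - 1) * y t))) (Ici 0) t
  n_nonneg : ∀ t, 0 ≤ t → 0 ≤ n t
  n_le : ∀ t, 0 ≤ t → n t ≤ ρ t
  sq_add_sq : ∀ t, 0 ≤ t → x t ^ 2 + y t ^ 2 = n t ^ s
  ρ_zero : ρ 0 = 1
  x_zero : 0 < x 0
  y_zero : y 0 ^ 2 ≤ 3 * x 0 ^ 2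

namespace ReducedFlow

variable {s : ℕ} {D : ℝ} {n ρ x y : ℝ → ℝ} (F : ReducedFlow s D n ρ x y)
include F

theorem ρ_nonneg {t : ℝ} (ht : 0 ≤ t) : 0 ≤ ρ t := (F.n_nonneg t ht).trans (F.n_le t ht)

theorem x_sq_le {t : ℝ} (ht : 0 ≤ t) : x t ^ 2 ≤ ρ t ^ s := by
  have h1 := F.sq_add_sq t ht
  have h2 := pow_le_pow_left₀ (F.n_nonneg t ht) (F.n_le t ht) s
  nlinarith [sq_nonneg (y t)]

/-- Since `x² ≤ ρ^s`, the inequality `ρ > 1` would force `x ≤ ρ^s`, that is `ρ' ≤ 0`. -/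
theorem ρ_le_one {t : ℝ} (ht : 0 ≤ t) : ρ t ≤ 1 := by
  have := barrier_le (f := fun t => -ρ t) (K := -1) (fun t ht => (F.deriv_ρ t ht).neg) le_rfl ht
    (by simp [F.ρ_zero]) fun t ht hlt => by
      have h1 : 1 ≤ ρ t ^ s := one_le_pow₀ (by linarith)
      have h2 := F.x_sq_le ht
      have : x t ≤ ρ t ^ s := abs_le_of_sq_le_sq' (by nlinarith) (by linarith) |>.2
      linarith
  linarith

theorem n_le_one {t : ℝ} (ht : 0 ≤ t) : n t ≤ 1 := (F.n_le t ht).trans (F.ρ_le_one ht)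

/-- Two passes: `x' ≥ 0` wherever `x < 0` gives `x ≥ 0`; then `ρ ≤ 1` gives `x' ≥ -s x`, so `x`
stays above a positive exponential. -/
theorem x_pos {t : ℝ} (ht : 0 ≤ t) : 0 < x t := by
  have hnn : ∀ t, 0 ≤ t → 0 ≤ x t := fun t ht =>
    barrier_le F.deriv_x le_rfl ht F.x_zero.le fun t ht hlt => by
      have h1 := pow_nonneg (F.n_nonneg t ht) (s - 1)
      have h2 := pow_nonneg (F.ρ_nonneg ht) (s - 1)
      have h3 := F.hD0
      have : 0 ≤ D * n t ^ (s - 1) - ρ t ^ (s - 1) * x t := by nlinarith [mul_nonneg h3 h1]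
      positivity
  have := exp_decay_le (f := fun t => -x t) (κ := s) (fun t ht => (F.deriv_x t ht).neg) le_rfl ht
    fun t ht => by
      have h0 : 0 ≤ t := ht.1.le
      have h1 := pow_nonneg (F.n_nonneg t h0) (s - 1)
      have h2 := pow_le_one₀ (n := s - 1) (F.ρ_nonneg h0) (F.ρ_le_one h0)
      have h3 : 0 ≤ x t := hnn t h0
      have h4 : 0 ≤ D * n t ^ (s - 1) - ρ t ^ (s - 1) * x t + x t := by
        nlinarith [mul_nonneg F.hD0 h1]
      have h5 : (0 : ℝ) ≤ s := by positivity
      nlinarith [mul_nonneg h5 h4]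
  have h2 := mul_pos F.x_zero (Real.exp_pos (-(s : ℝ) * (t - 0)))
  nlinarith

theorem n_pos {t : ℝ} (ht : 0 ≤ t) : 0 < n t := by
  have h1 := F.sq_add_sq t ht
  have h2 := F.x_pos ht
  refine lt_of_le_of_ne (F.n_nonneg t ht) fun h => ?_
  have hs := F.hs
  rw [← h, zero_pow (by omega)] at h1
  nlinarith [sq_nonneg (y t)]

theorem ρ_pos {t : ℝ} (ht : 0 ≤ t) : 0 < ρ t := (F.n_pos ht).trans_le (F.n_le t ht)

theorem x_le_one {t : ℝ} (ht : 0 ≤ t) : x t ≤ 1 := by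
  have h1 := F.x_sq_le ht
  have h2 := pow_le_one₀ (n := s) (F.ρ_nonneg ht) (F.ρ_le_one ht)
  nlinarith [F.x_pos ht]

/-- The damping `-s ρ^(s-1)` acts equally on `x` and `y` and cancels in the quotient, which is the
tangent of the phase of `m^s`. -/
theorem deriv_tan_sq {t : ℝ} (ht : 0 ≤ t) :
    HasDerivWithinAt (fun t => (y t / x t) ^ 2)
      (-(2 * (s * (D * (n t ^ (s - 1) / x t)))) * (y t / x t) ^ 2) (Ici 0) t := by
  have hx := (F.x_pos ht).ne'
  refine (((F.deriv_y t ht).div (F.deriv_x t ht) hx).pow 2).congr_deriv ?_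
  simp only [Pi.div_apply, Nat.cast_ofNat, Nat.add_one_sub_one, pow_one]
  field_simp
  ring

/-- Again the damping cancels. What remains drives the squared cosine of the angle between `Aw` and
`h*` towards `D`, at a speed controlled by `x`. -/
theorem deriv_ratio {t : ℝ} (ht : 0 ≤ t) :
    HasDerivWithinAt (fun t => n t / ρ t) (2 * (x t / ρ t) * (D - n t / ρ t)) (Ici 0) t := by
  have hρ := (F.ρ_pos ht).ne'
  refine ((F.deriv_n t ht).div (F.deriv_ρ t ht) hρ).congr_deriv ?_
  obtain ⟨k, rfl⟩ : ∃ k, s = k + 1 := ⟨s - 1, by have := F.hs; omega⟩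
  rw [Nat.add_sub_cancel]
  field_simp
  ring

theorem tan_sq_le {a b : ℝ} (ha : 0 ≤ a) (hab : a ≤ b) :
    (y b / x b) ^ 2 ≤ (y a / x a) ^ 2 := by
  have := exp_decay_le (κ := 0) (fun t ht => F.deriv_tan_sq ht) ha hab fun t ht => by
    have h0 : 0 ≤ t := ha.trans ht.1.le
    have h1 := F.n_nonneg t h0
    have h2 := (F.x_pos h0).le
    have h3 := F.hD0
    have : 0 ≤ 2 * (s * (D * (n t ^ (s - 1) / x t))) * (y t / x t) ^ 2 := by positivity
    linarith
  simpa using this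

theorem tan_sq_le_three {t : ℝ} (ht : 0 ≤ t) : (y t / x t) ^ 2 ≤ 3 := by
  refine (F.tan_sq_le le_rfl ht).trans ?_
  rw [div_pow, div_le_iff₀ (by have := F.x_zero; positivity)]
  exact F.y_zero

theorem sq_mul_tan {t : ℝ} (ht : 0 ≤ t) : x t ^ 2 * (1 + (y t / x t) ^ 2) = n t ^ s := by
  rw [← F.sq_add_sq t ht]
  have := (F.x_pos ht).ne'
  field_simp

theorem n_pow_le {t : ℝ} (ht : 0 ≤ t) : n t ^ s ≤ 4 * x t ^ 2 := by
  rw [← F.sq_mul_tan ht]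
  nlinarith [F.tan_sq_le_three ht, sq_nonneg (x t)]

end ReducedFlow

/-- The total relaxation time obtained for `s ≥ 2` is within the claimed bound. -/
theorem time_bound {s : ℕ} (hs2 : 2 ≤ s) {r ε : ℝ} (hr : 0 < r) (hr1 : r ≤ 1) (hε : 0 < ε)
    (hε1 : ε < 1) :
    4 * s * (4 / r ^ 2) ^ s + 2 * (4 / r ^ 2) ^ s + 8 * Real.log (4096 / ε ^ 2)
      + 2048 * Real.log (4 / ε) ≤ 41000 * (2 ^ (s ^ 2) * (r ^ (4 * s))⁻¹ + Real.log (1 / ε)) := by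
  -- Uses `s ≤ 2^(s-1) ≤ 2^((s-1)²)` and `(s-1)² + 2s = s² + 1`.
  have h1 : (s : ℝ) * 4 ^ s ≤ 2 * 2 ^ (s ^ 2) := by
    obtain ⟨k, rfl⟩ : ∃ k, s = k + 2 := ⟨s - 2, by omega⟩
    have h2 : k + 2 ≤ 2 ^ (k + 1) := Nat.lt_two_pow_self
    have h3 : (2 : ℕ) ^ (k + 1) ≤ 2 ^ ((k + 1) ^ 2) :=
      Nat.pow_le_pow_right (by norm_num) (Nat.le_self_pow (by norm_num) _)
    have h4 : (k + 2) * 4 ^ (k + 2) ≤ 2 * 2 ^ ((k + 2) ^ 2) := by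
      calc (k + 2) * 4 ^ (k + 2) ≤ 2 ^ ((k + 1) ^ 2) * 4 ^ (k + 2) :=
            Nat.mul_le_mul_right _ (h2.trans h3)
        _ = 2 * 2 ^ ((k + 2) ^ 2) := by
            rw [show (4 : ℕ) = 2 ^ 2 by norm_num, ← pow_mul, ← pow_add, ← pow_succ']
            congr 1
            ring
    exact_mod_cast h4
  have hs : (2 : ℝ) ≤ s := by exact_mod_cast hs2
  have h5 : (4 / r ^ 2) ^ s ≤ 4 ^ s * (r ^ (4 * s))⁻¹ := by
    rw [div_pow, div_eq_mul_inv, ← pow_mul]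
    gcongr ?_ * ?_
    exact inv_anti₀ (by positivity) (pow_le_pow_of_le_one hr.le hr1 (by omega))
  set R := (r ^ (4 * s))⁻¹
  have hR : 1 ≤ R := (one_le_inv₀ (by positivity)).2 (pow_le_one₀ hr.le hr1)
  have h6 : (1 : ℝ) ≤ 2 ^ (s ^ 2) := one_le_pow₀ (by norm_num)
  have h7 : 1 ≤ 2 ^ (s ^ 2) * R := by nlinarith
  have h8 : s * (4 ^ s * R) ≤ 2 * (2 ^ (s ^ 2) * R) := by nlinarith
  have h9 : 0 ≤ Real.log (1 / ε) := Real.log_nonneg (by rw [le_div_iff₀ hε]; linarith)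
  have h10 : Real.log (4096 / ε ^ 2) = Real.log 4096 + 2 * Real.log (1 / ε) := by
    rw [Real.log_div (by norm_num) (by positivity), Real.log_pow, one_div, Real.log_inv]
    push_cast
    ring
  have h11 : Real.log (4 / ε) = Real.log 4 + Real.log (1 / ε) := by
    rw [Real.log_div (by norm_num) hε.ne', one_div, Real.log_inv]
    ring
  have h12 : Real.log 4096 ≤ 4095 := by linarith [Real.log_le_sub_one_of_pos (x := 4096) (by norm_num)]
  have h13 : Real.log 4 ≤ 3 := by linarith [Real.log_le_sub_one_of_pos (x := 4) (by norm_num)]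
  have h14 : 0 ≤ (4 / r ^ 2) ^ s := by positivity
  have h15 : 4 * s * (4 / r ^ 2) ^ s + 2 * (4 / r ^ 2) ^ s ≤ 5 * (s * (4 ^ s * R)) := by
    nlinarith [mul_le_mul_of_nonneg_left h5 (by linarith : (0 : ℝ) ≤ s)]
  rw [h10, h11]
  nlinarith

/-! ### Escape from initialization and exponential convergence of the reduced system -/

namespace ReducedFlow

variable {s : ℕ} {D : ℝ} {n ρ x y : ℝ → ℝ} (F : ReducedFlow s D n ρ x y)
include F

theorem n_zero_le_one : n 0 ≤ 1 := F.n_le_one le_rfl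

theorem n_zero_pos : 0 < n 0 := F.n_pos le_rfl

theorem half_le_ratio (hD : 1 / 2 ≤ D) {t : ℝ} (ht : 0 ≤ t) : n 0 / 2 ≤ n t / ρ t := by
  refine barrier_le (f := fun t => n t / ρ t) (fun t ht => F.deriv_ratio ht) le_rfl ht ?_
    fun t ht hlt => ?_
  · have := F.n_zero_pos
    simp only [F.ρ_zero]
    linarith
  · have h1 := F.n_zero_le_one
    have h2 : 0 ≤ D - n t / ρ t := by linarith
    have h3 := F.x_pos ht
    have h4 := F.ρ_pos ht
    positivity

theorem ratio_pow_mul {t : ℝ} (ht : 0 ≤ t) : (n t / ρ t) ^ s * ρ t ^ s = n t ^ s := by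
  rw [← mul_pow, div_mul_cancel₀ _ (F.ρ_pos ht).ne']

/-- Below `n 0 / 8` the drive wins: `4x² ≥ (n/ρ)^s ρ^s ≥ (n 0 / 2)^s ρ^s ≥ 4 ρ^(2s)`, so `x ≥ ρ^s`
and `ρ' ≥ 0`. -/
theorem eighth_le_ρ (hD : 1 / 2 ≤ D) {t : ℝ} (ht : 0 ≤ t) : n 0 / 8 ≤ ρ t := by
  have hq := F.n_zero_pos
  refine barrier_le F.deriv_ρ le_rfl ht ?_ fun t ht hlt => ?_
  · rw [F.ρ_zero]
    linarith [F.n_zero_le_one]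
  · have h1 := F.n_pow_le ht
    rw [← F.ratio_pow_mul ht] at h1
    have hρ := pow_pos (F.ρ_pos ht) s
    have h2 : (n 0 / 2) ^ s ≤ (n t / ρ t) ^ s :=
      pow_le_pow_left₀ (by positivity) (F.half_le_ratio hD ht) s
    have h3 : ρ t ^ s ≤ (n 0 / 8) ^ s := pow_le_pow_left₀ (F.ρ_nonneg ht) hlt.le s
    have h4 : 4 * (n 0 / 8) ^ s ≤ (n 0 / 2) ^ s := by
      have h5 : n 0 / 2 = 4 * (n 0 / 8) := by ring
      rw [h5, mul_pow]
      gcongr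
      exact le_self_pow₀ (by norm_num) (by have := F.hs; omega)
    have h6 : (ρ t ^ s) ^ 2 ≤ x t ^ 2 := by nlinarith
    have h7 := abs_le_of_sq_le_sq' h6 (F.x_pos ht).le |>.2
    linarith

/-- The bounds on `n/ρ` and `ρ` multiply to `n ≥ (n 0 / 4)²`, while the preserved phase gives `x ≥
n^(s/2) / 2`. This is the speed that governs the slow stage. -/
theorem x_lower_bound (hD : 1 / 2 ≤ D) {t : ℝ} (ht : 0 ≤ t) : (n 0 / 4) ^ s / 2 ≤ x t := by
  have hq := F.n_zero_pos
  have h1 := F.n_pow_le ht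
  rw [← F.ratio_pow_mul ht, ← mul_pow] at h1
  have h2 : ((n 0 / 4) ^ s) ^ 2 ≤ (n t / ρ t * ρ t) ^ s := by
    rw [← pow_mul, mul_comm s 2, pow_mul]
    refine pow_le_pow_left₀ (by positivity) ?_ s
    nlinarith [mul_le_mul (F.half_le_ratio hD ht) (F.eighth_le_ρ hD ht) (by positivity)
      ((by positivity : 0 ≤ n 0 / 2).trans (F.half_le_ratio hD ht))]
  have h3 : ((n 0 / 4) ^ s / 2) ^ 2 ≤ x t ^ 2 := by nlinarith
  exact abs_le_of_sq_le_sq' h3 (F.x_pos ht).le |>.2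

theorem x_le_x_div_ρ {t : ℝ} (ht : 0 ≤ t) : x t ≤ x t / ρ t :=
  le_div_self (F.x_pos ht).le (F.ρ_pos ht) (F.ρ_le_one ht)

/-- After time of order `s 4^s r₀^{-2s}` the ratio `|m|² / ‖A w‖²` is within `1 / (4 s)` of `D`. -/
theorem ratio_ge_of_le (hD : 1 / 2 ≤ D) {t : ℝ} (ht : 4 * s * (4 / n 0) ^ s ≤ t) :
    D - 1 / (4 * s) ≤ n t / ρ t := by
  have hq := F.n_zero_pos
  have hs : (0 : ℝ) < s := by exact_mod_cast F.hs
  have ht0 : 0 ≤ t := le_trans (by positivity) ht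
  refine reach_le (f := fun t => n t / ρ t) (κ := (n 0 / 4) ^ s / (4 * s))
    (fun t ht => F.deriv_ratio ht) le_rfl ht0 (by positivity) ?_ fun t ht hlt => ?_
  · have h1 : (1 : ℝ) ≤ (n 0 / 4) ^ s / (4 * s) * t := by
      calc (1 : ℝ) = (n 0 / 4) ^ s / (4 * s) * (4 * s * (4 / n 0) ^ s) := by
            rw [div_mul_eq_mul_div, mul_comm (4 * (s : ℝ)), ← mul_assoc, ← mul_pow]
            field_simp
            norm_num
        _ ≤ _ := by gcongr
    have h2 : 0 ≤ n 0 / ρ 0 := by rw [F.ρ_zero]; linarith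
    have h3 : 0 ≤ 1 / (4 * (s : ℝ)) := by positivity
    have h4 := F.hD1
    simp only [sub_zero]
    linarith
  · have h1 := F.x_lower_bound hD ht
    have h2 := F.x_le_x_div_ρ ht
    have h3 : 1 / (4 * (s : ℝ)) ≤ D - n t / ρ t := by linarith
    calc (n 0 / 4) ^ s / (4 * s) = 2 * ((n 0 / 4) ^ s / 2) * (1 / (4 * s)) := by ring
      _ ≤ 2 * (x t / ρ t) * (D - n t / ρ t) := by
        have h4 : (0 : ℝ) ≤ x t / ρ t := (F.x_pos ht).le.trans h2
        exact mul_le_mul (by linarith) h3 (by positivity) (by positivity)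

/-- Bernoulli's inequality; this is why the direction must first be accurate to order `1/s`. -/
theorem half_le_ratio_pow {t : ℝ} (hr : 1 - 1 / (2 * s) ≤ n t / ρ t) :
    1 / 2 ≤ (n t / ρ t) ^ s := by
  have hs : (1 : ℝ) ≤ s := by exact_mod_cast F.hs
  have h1 : 1 / (2 * (s : ℝ)) ≤ 1 := by
    rw [div_le_one (by positivity)]
    linarith
  have h2 := one_add_mul_le_pow (a := -(1 / (2 * (s : ℝ)))) (by linarith) s
  have h3 : (s : ℝ) * -(1 / (2 * s)) = -1 / 2 := by field_simp
  calc (1 : ℝ) / 2 = 1 + s * -(1 / (2 * s)) := by rw [h3]; norm_num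
    _ ≤ _ := h2
    _ ≤ _ := pow_le_pow_left₀ (by linarith) (by linarith) s

/-- Once `|m|² / ‖A w‖²` stays close to `1`, the norm `‖A w‖` becomes of order one. -/
theorem ρ_pow_ge_of_le (hD : 1 / 2 ≤ D) {a t : ℝ} (ha : 0 ≤ a)
    (hr : ∀ t, a ≤ t → 1 - 1 / (2 * s) ≤ n t / ρ t) (ht : a + 2 * (4 / n 0) ^ s ≤ t) :
    1 / 32 ≤ ρ t ^ s := by
  have hq := F.n_zero_pos
  have hs := F.hs
  have hat : a ≤ t := le_trans (by linarith [(by positivity : 0 ≤ 2 * (4 / n 0) ^ s)]) ht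
  -- `K = 32^(-1/s)` lets the barrier argument run on `ρ` itself. Below it `4x² ≥ ρ^s / 2 ≥ 16
  -- ρ^(2s)`, so `x ≥ 2ρ^s` and `ρ' ≥ x`.
  obtain ⟨K, hK0, hK⟩ : ∃ K : ℝ, 0 ≤ K ∧ K ^ s = 1 / 32 :=
    ⟨(1 / 32 : ℝ) ^ ((s : ℝ)⁻¹), by positivity, Real.rpow_inv_natCast_pow (by norm_num) (by omega)⟩
  have hK1 : K ≤ 1 := by
    by_contra! h
    have := one_le_pow₀ h.le (n := s)
    linarith
  have : K ≤ ρ t := by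
    refine reach_le (κ := (n 0 / 4) ^ s / 2) F.deriv_ρ ha hat (by positivity) ?_ fun t ht hlt => ?_
    · have h1 : (1 : ℝ) ≤ (n 0 / 4) ^ s / 2 * (t - a) := by
        calc (1 : ℝ) = (n 0 / 4) ^ s / 2 * (2 * (4 / n 0) ^ s) := by
              rw [div_mul_eq_mul_div, mul_comm (2 : ℝ), ← mul_assoc, ← mul_pow]
              field_simp
              norm_num
          _ ≤ _ := by gcongr; linarith
      have := F.ρ_nonneg ha
      linarith
    · have h0 := ha.trans ht
      have h1 := F.x_lower_bound hD h0
      have h2 : ρ t ^ s ≤ 1 / 32 := hK ▸ pow_le_pow_left₀ (F.ρ_nonneg h0) hlt.le s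
      have h3 := F.n_pow_le h0
      rw [← F.ratio_pow_mul h0] at h3
      have h4 := F.half_le_ratio_pow (hr t ht)
      have h5 := pow_nonneg (F.ρ_nonneg h0) s
      have h6 : (2 * ρ t ^ s) ^ 2 ≤ x t ^ 2 := by nlinarith
      have h7 := abs_le_of_sq_le_sq' h6 (F.x_pos h0).le |>.2
      linarith
  exact hK ▸ pow_le_pow_left₀ hK0 this s

theorem sixteenth_le_x {t : ℝ} (ht : 0 ≤ t) (hr : 1 - 1 / (2 * s) ≤ n t / ρ t)
    (hρ : 1 / 32 ≤ ρ t ^ s) : 1 / 16 ≤ x t := by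
  have h3 := F.n_pow_le ht
  rw [← F.ratio_pow_mul ht] at h3
  have h4 := F.half_le_ratio_pow hr
  have h6 : (1 / 16 : ℝ) ^ 2 ≤ x t ^ 2 := by nlinarith
  exact abs_le_of_sq_le_sq' h6 (F.x_pos ht).le |>.2

theorem deriv_ratio_sq {t : ℝ} (ht : 0 ≤ t) :
    HasDerivWithinAt (fun t => (D - n t / ρ t) ^ 2)
      (-(4 * (x t / ρ t)) * (D - n t / ρ t) ^ 2) (Ici 0) t := by
  refine (((F.deriv_ratio ht).const_sub D).pow 2).congr_deriv ?_
  simp only [Nat.cast_ofNat, Nat.add_one_sub_one, pow_one]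
  ring

theorem ratio_sq_decay {a t : ℝ} (ha : 0 ≤ a) (hx : ∀ t, a ≤ t → 1 / 16 ≤ x t) (ht : a ≤ t) :
    (D - n t / ρ t) ^ 2 ≤ Real.exp (-(1 / 8) * (t - a)) := by
  have h := exp_decay_le (κ := 1 / 8) (fun t ht => F.deriv_ratio_sq ht) ha ht fun t ht => by
    have h1 := hx t ht.1.le
    have h2 := F.x_le_x_div_ρ (ha.trans ht.1.le)
    nlinarith [sq_nonneg (D - n t / ρ t)]
  refine h.trans (mul_le_of_le_one_left (Real.exp_pos _).le ?_)
  have h1 : 0 ≤ n a / ρ a := div_nonneg (F.n_nonneg a ha) (F.ρ_nonneg ha)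
  have h2 : n a / ρ a ≤ 1 := div_le_one_of_le₀ (F.n_le a ha) (F.ρ_nonneg ha)
  nlinarith [F.hD0, F.hD1]

theorem tan_sq_decay (hs2 : 2 ≤ s) (hD : 1 / 2 ≤ D) {a t : ℝ} (ha : 0 ≤ a)
    (hx : ∀ t, a ≤ t → 1 / 16 ≤ x t) (ht : a ≤ t) :
    (y t / x t) ^ 2 ≤ 3 * Real.exp (-(1 / 8) * (t - a)) := by
  have hs : (2 : ℝ) ≤ s := by exact_mod_cast hs2
  have h := exp_decay_le (κ := 1 / 8) (fun t ht => F.deriv_tan_sq ht) ha ht fun t ht => by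
    have h0 := ha.trans ht.1.le
    have h1 := hx t ht.1.le
    have hxt := F.x_pos h0
    have h2 : x t ^ 2 ≤ n t ^ (s - 1) := by
      refine le_trans ?_ (pow_le_pow_of_le_one (F.n_nonneg t h0) (F.n_le_one h0) (Nat.sub_le s 1))
      rw [← F.sq_add_sq t h0]
      nlinarith [sq_nonneg (y t)]
    -- From `x² ≤ n^s ≤ n^(s-1)` the quotient is at least `x ≥ 1/16`. With `s ≥ 2` and `D ≥ 1/2` the
    -- rate becomes `1/8`, the same as the one used for the direction.
    have h3 : 1 / 16 ≤ n t ^ (s - 1) / x t := by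
      rw [le_div_iff₀ hxt]
      nlinarith
    have h4 : 1 / 8 ≤ 2 * (s * (D * (n t ^ (s - 1) / x t))) := by
      calc (1 : ℝ) / 8 = 2 * (2 * (1 / 2 * (1 / 16))) := by norm_num
        _ ≤ _ := by gcongr
    nlinarith [sq_nonneg (y t / x t)]
  refine h.trans ?_
  have := F.tan_sq_le_three ha
  gcongr

/-- Once `m` has the right phase and `A w` the right direction, `ρ` relaxes to `D`. -/
theorem ρ_ge_of_le {ε : ℝ} (hε : 0 < ε) (hε1 : ε < 1) {a t : ℝ} (ha : 0 ≤ a)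
    (hρ : ∀ t, a ≤ t → 1 / 32 ≤ ρ t ^ s) (hr : ∀ t, a ≤ t → D - ε / 64 ≤ n t / ρ t)
    (hp : ∀ t, a ≤ t → (y t / x t) ^ 2 ≤ ε / 1024) (ht : a + 2048 * Real.log (4 / ε) ≤ t) :
    D - ε / 4 ≤ ρ t := by
  have hs := F.hs
  have hlog : 0 < Real.log (4 / ε) := Real.log_pos (by rw [lt_div_iff₀ hε]; linarith)
  have hat : a ≤ t := by linarith
  have hgrow : ∀ t, a ≤ t → ρ t < D - ε / 4 → (D - ρ t) / 2048 ≤ 2 * (x t - ρ t ^ s) := by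
    intro t ht hlt
    have h0 := ha.trans ht
    have h1 := hρ t ht
    have h2 := hr t ht
    have h3 := hp t ht
    have h4 := F.sq_mul_tan h0
    have h5 : n t / ρ t ≤ 1 := div_le_one_of_le₀ (F.n_le t h0) (F.ρ_nonneg h0)
    have h5' : (n t / ρ t) ^ s ≤ 1 := pow_le_one₀ (div_nonneg (F.n_nonneg t h0) (F.ρ_nonneg h0)) h5
    rw [← F.ratio_pow_mul h0] at h4
    set ω := n t / ρ t
    set p := (y t / x t) ^ 2
    have hp0 : 0 ≤ p := sq_nonneg _
    have hρ0 := F.ρ_pos h0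
    have h6 : ρ t ^ s * (ω - ρ t) ≤ ω ^ s - ρ t ^ s := by
      obtain ⟨k, rfl⟩ : ∃ k, s = k + 1 := ⟨s - 1, by omega⟩
      have h7 : ρ t ^ k ≤ ω ^ k := pow_le_pow_left₀ hρ0.le (by linarith) k
      have h8 : ρ t ^ (k + 1) ≤ ρ t ^ k :=
        pow_le_pow_of_le_one hρ0.le (F.ρ_le_one h0) (Nat.le_succ k)
      have h9 : 0 ≤ ω - ρ t := by linarith
      have h10 : ρ t ^ (k + 1) * (ω - ρ t) ≤ ρ t ^ k * (ω - ρ t) := by gcongr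
      have h11 : ρ t ^ k * ω ≤ ω ^ k * ω := by
        have : 0 ≤ ω := by linarith
        gcongr
      rw [pow_succ ω, pow_succ (ρ t)] at *
      linarith
    -- As `D - ρ > ε/4`, the error `ε/64` in `ω` costs at most `1/16` of the gap, leaving
    -- `(1/32)(15/16) = 15/512`; the phase error `ε/1024` costs another `2/512`.
    have h7 : 13 / 512 * (D - ρ t) ≤ ω ^ s - ρ t ^ s - p := by
      nlinarith [mul_le_mul_of_nonneg_right h1 (by linarith : 0 ≤ ω - ρ t)]
    have h8 : ω ^ s * ρ t ^ s - x t ^ 2 ≤ p * ρ t ^ s := by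
      have hω0 : 0 ≤ ω ^ s := pow_nonneg (by linarith) s
      have : x t ^ 2 ≤ ρ t ^ s := by nlinarith [sq_nonneg (x t)]
      nlinarith
    have hgap : 0 ≤ D - ρ t := by linarith
    have h9 : (1 / 32) * (13 / 512 * (D - ρ t)) ≤ x t ^ 2 - (ρ t ^ s) ^ 2 := by
      have : ρ t ^ s * (13 / 512 * (D - ρ t)) ≤ ρ t ^ s * (ω ^ s - ρ t ^ s - p) := by gcongr
      nlinarith [mul_le_mul_of_nonneg_right h1 (by linarith : 0 ≤ 13 / 512 * (D - ρ t))]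
    have h10 : ρ t ^ s ≤ 1 := pow_le_one₀ hρ0.le (F.ρ_le_one h0)
    have h11 := F.x_le_one h0
    have h12 := F.x_pos h0
    have h13 : ρ t ^ s ≤ x t := abs_le_of_sq_le_sq' (by linarith) h12.le |>.2
    -- Since `x + ρ^s ≤ 2`, `2(x - ρ^s) ≥ x² - ρ^(2s)`, and `13/16384 ≥ 1/2048`.
    nlinarith [mul_nonneg (sub_nonneg.2 h13) (by linarith : 0 ≤ 2 - x t - ρ t ^ s)]
  by_contra! hlt
  have hbelow : ∀ u ∈ Icc a t, ρ u < D - ε / 4 := by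
    intro u hu
    by_contra! hK
    refine (barrier_le F.deriv_ρ (ha.trans hu.1) hu.2 hK fun v hv hfv => ?_).not_gt hlt
    exact (by linarith : 0 ≤ (D - ρ v) / 2048).trans (hgrow v (hu.1.trans hv) hfv)
  have := exp_decay_le (f := fun t => D - ρ t) (κ := 1 / 2048)
    (fun t ht => (F.deriv_ρ t ht).const_sub D) ha hat fun u hu => by
      linarith [hgrow u hu.1.le (hbelow u ⟨hu.1.le, hu.2.le⟩)]
  have h1 : Real.exp (-(1 / 2048) * (t - a)) ≤ ε / 4 := by
    have : ε / 4 = Real.exp (-Real.log (4 / ε)) := by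
      rw [Real.exp_neg, Real.exp_log (by positivity), inv_div]
    rw [this, Real.exp_le_exp]
    linarith
  have h2 := F.ρ_nonneg ha
  have h3 := F.hD1
  nlinarith [Real.exp_pos (-(1 / 2048) * (t - a))]

/-- The four summands of `T` are successive stages: `n/ρ` comes within `1/(4s)` of `D`; `ρ^s`
reaches `1/32`; direction and phase converge exponentially; finally `ρ` relaxes to `D`. -/
theorem target_of_two_le (hs2 : 2 ≤ s) {ε : ℝ} (hε : 0 < ε) (hε1 : ε < 1)
    (hDs : 1 - D ≤ 1 / (4 * s)) (hDε : 1 - D ≤ ε / 2) {T : ℝ}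
    (hT : T = 4 * s * (4 / n 0) ^ s + 2 * (4 / n 0) ^ s + 8 * Real.log (4096 / ε ^ 2)
      + 2048 * Real.log (4 / ε)) :
    0 ≤ T ∧ (1 - ε) ^ 2 ≤ n T ∧ (1 - ε) ^ 2 * n T ^ s ≤ x T ^ 2 ∧ ρ T - n T ≤ ε := by
  have hq := F.n_zero_pos
  have hs : (2 : ℝ) ≤ s := by exact_mod_cast hs2
  have hs' : 1 / (4 * (s : ℝ)) ≤ 1 / 8 := one_div_le_one_div_of_le (by norm_num) (by linarith)
  have hs'' : 1 / (2 * (s : ℝ)) = 1 / (4 * s) + 1 / (4 * s) := by field_simp; norm_num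
  have hD : 1 / 2 ≤ D := by linarith
  have hl1 : 0 < Real.log (4 / ε) := Real.log_pos (by rw [lt_div_iff₀ hε]; linarith)
  have hl2 : 0 < Real.log (4096 / ε ^ 2) :=
    Real.log_pos (by rw [lt_div_iff₀ (by positivity)]; nlinarith)
  have hp1 : 0 ≤ 4 * s * (4 / n 0) ^ s := by positivity
  have hp2 : 0 ≤ 2 * (4 / n 0) ^ s := by positivity
  have hr : ∀ t, 4 * s * (4 / n 0) ^ s ≤ t → 1 - 1 / (2 * s) ≤ n t / ρ t := fun t ht => by
    have := F.ratio_ge_of_le hD ht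
    linarith
  set a := 4 * s * (4 / n 0) ^ s + 2 * (4 / n 0) ^ s with ha
  have ha0 : 0 ≤ a := by linarith
  have hρ : ∀ t, a ≤ t → 1 / 32 ≤ ρ t ^ s := fun t ht => F.ρ_pow_ge_of_le hD hp1 hr ht
  have hx : ∀ t, a ≤ t → 1 / 16 ≤ x t := fun t ht =>
    F.sixteenth_le_x (ha0.trans ht) (hr t (by linarith)) (hρ t ht)
  -- The value `ε²/4096 = (ε/64)²` is what the squared direction error needs; it also covers the
  -- bound `ε/1024` on the squared tangent.
  have hexp : ∀ t, a + 8 * Real.log (4096 / ε ^ 2) ≤ t →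
      Real.exp (-(1 / 8) * (t - a)) ≤ ε ^ 2 / 4096 := fun t ht => by
    have : ε ^ 2 / 4096 = Real.exp (-Real.log (4096 / ε ^ 2)) := by
      rw [Real.exp_neg, Real.exp_log (by positivity), inv_div]
    rw [this, Real.exp_le_exp]
    linarith
  set b := a + 8 * Real.log (4096 / ε ^ 2)
  have hab : a ≤ b := by linarith
  have hrb : ∀ t, b ≤ t → D - ε / 64 ≤ n t / ρ t := fun t ht => by
    have h1 := (F.ratio_sq_decay ha0 hx (hab.trans ht)).trans (hexp t ht)
    have h2 : (D - n t / ρ t) ^ 2 ≤ (ε / 64) ^ 2 := by linarith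
    have := abs_le_of_sq_le_sq' h2 (by positivity) |>.2
    linarith
  have hpb : ∀ t, b ≤ t → (y t / x t) ^ 2 ≤ ε / 1024 := fun t ht => by
    have h1 := F.tan_sq_decay hs2 hD ha0 hx (hab.trans ht)
    have h2 := hexp t ht
    nlinarith
  have hbT : b ≤ T := by linarith
  have hT0 : 0 ≤ T := by linarith
  have h1 := F.ρ_ge_of_le hε hε1 (by linarith) (fun t ht => hρ t (hab.trans ht)) hrb hpb hT.ge
  have h2 := hrb T hbT
  have h3 := hpb T hbT
  have h4 := F.ρ_le_one hT0
  have h5 := F.ρ_pos hT0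
  have h6 : n T = n T / ρ T * ρ T := (div_mul_cancel₀ _ h5.ne').symm
  set ω := n T / ρ T
  refine ⟨hT0, ?_, ?_, ?_⟩
  · rw [h6, sq]
    exact mul_le_mul (by linarith) (by linarith) (by linarith) (by linarith)
  · rw [← F.sq_mul_tan hT0, mul_comm, mul_assoc]
    refine mul_le_of_le_one_right (sq_nonneg _) ?_
    nlinarith
  · have hn := F.n_le T hT0
    nlinarith

/-- Here `x' = D - x` and `y' = -y`, and `ρ - n - (1 - D)` decays at rate at least `2` because `x ≤
1`. With `exp (-T) = ε²` each estimate is explicit. -/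
theorem target_of_eq_one (hs1 : s = 1) {ε : ℝ} (hε : 0 < ε) (hε1 : ε < 1)
    (hDε : 1 - D ≤ ε / 2) {T : ℝ} (hT : T = 2 * Real.log (1 / ε)) :
    0 ≤ T ∧ (1 - ε) ^ 2 ≤ n T ∧ (1 - ε) ^ 2 * n T ^ s ≤ x T ^ 2 ∧ ρ T - n T ≤ ε := by
  subst hs1
  have hl : 0 < Real.log (1 / ε) := Real.log_pos (by rw [lt_div_iff₀ hε]; linarith)
  have hT0 : 0 ≤ T := by linarith
  have hexp : Real.exp (-T) = ε ^ 2 := by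
    rw [hT, one_div, Real.log_inv, ← Real.exp_log (pow_pos hε 2), Real.log_pow]
    push_cast
    ring_nf
  have hD0 := F.hD0
  have hD1 := F.hD1
  have hx : D * (1 - ε ^ 2) ≤ x T := by
    have := exp_decay_le (f := fun t => D - x t) (κ := 1) (fun t ht => (F.deriv_x t ht).const_sub D)
      le_rfl hT0 fun t ht => by simp
    have h1 : -(1 : ℝ) * (T - 0) = -T := by ring
    rw [h1, hexp] at this
    nlinarith [F.x_zero, sq_nonneg ε]
  have hε2 : ε ^ 2 ≤ 1 := pow_le_one₀ hε.le hε1.le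
  have hxε : 1 - ε ≤ x T := by
    have h1 : (1 - ε / 2) * (1 - ε ^ 2) ≤ D * (1 - ε ^ 2) := by
      gcongr
      · linarith
    nlinarith [mul_nonneg (mul_nonneg hε.le (by linarith : 0 ≤ 1 - ε)) (by linarith : 0 ≤ 1 - ε)]
  have hn : n T = x T ^ 2 + y T ^ 2 := by simpa using (F.sq_add_sq T hT0).symm
  refine ⟨hT0, ?_, ?_, ?_⟩
  · rw [hn]
    nlinarith [sq_nonneg (y T)]
  · rw [hn, pow_one]
    have hy : y T ^ 2 ≤ ε ^ 4 := by
      have := exp_decay_le (f := fun t => y t ^ 2) (κ := 2)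
        (fun t ht => (F.deriv_y t ht).pow 2) le_rfl hT0 fun t ht => by
          simp; linarith
      have h1 : -(2 : ℝ) * (T - 0) = -T + -T := by ring
      rw [h1, Real.exp_add, hexp] at this
      have h2 : y 0 ^ 2 ≤ 1 := by
        have := F.sq_add_sq 0 le_rfl
        have := F.n_zero_le_one
        nlinarith [sq_nonneg (x 0)]
      nlinarith [sq_nonneg (ε ^ 2)]
    -- For small `ε`, `x T` is bounded below and `y T ^ 2 ≤ ε⁴` is negligible. For `ε ≥ 1/2` the
    -- preserved bound `n ≤ 4x²` already suffices, as `(1 - ε)² ≤ 1/4`.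
    rcases le_total ε (1 / 2) with h | h
    · have h1 : 9 / 16 ≤ x T := by
        have h2 : ε ^ 2 ≤ 1 / 4 := by nlinarith
        have h3 : 3 / 4 ≤ D := by linarith
        have h4 : (3 : ℝ) / 4 * (3 / 4) ≤ D * (1 - ε ^ 2) := by
          gcongr
          linarith
        linarith
      have h2 : ε ^ 4 ≤ ε * (1 / 8) := by
        have : ε ^ 3 ≤ (1 / 2) ^ 3 := pow_le_pow_left₀ hε.le h 3
        nlinarith
      have h3 : (1 - ε) ^ 2 ≤ 1 - ε := by nlinarith
      have h4 : (1 - ε) ^ 2 * (x T ^ 2 + y T ^ 2) ≤ (1 - ε) * (x T ^ 2 + ε * (1 / 8)) := by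
        gcongr
        linarith
      have h5 : 1 / 8 ≤ x T ^ 2 := by nlinarith
      nlinarith [mul_nonneg hε.le (sub_nonneg.2 h5), mul_nonneg hε.le hε.le]
    · have h1 := F.n_pow_le hT0
      rw [pow_one, hn] at h1
      have h2 : (1 - ε) ^ 2 ≤ 1 / 4 := by nlinarith
      nlinarith [sq_nonneg (x T), sq_nonneg (y T)]
  · have hv := exp_decay_le (f := fun t => ρ t - n t - (1 - D)) (κ := 2)
      (fun t ht => ((F.deriv_ρ t ht).sub (F.deriv_n t ht)).sub_const (1 - D)) le_rfl hT0
      fun t ht => by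
        have := F.x_le_one ht.1.le
        simp
        nlinarith
    have h1 : -(2 : ℝ) * (T - 0) = -T + -T := by ring
    rw [h1, Real.exp_add, hexp, F.ρ_zero] at hv
    have h2 := F.n_zero_pos
    have h3 : ρ T - n T ≤ (1 - D) + D * ε ^ 4 := by nlinarith [pow_pos hε 4]
    have h4 : (1 - ε / 2) * ε ^ 3 ≤ 1 / 2 := by nlinarith [sq_nonneg (1 - ε), sq_nonneg ε, sq_nonneg (ε * (1 - ε))]
    have h5 : (1 - D) + D * ε ^ 4 ≤ ε / 2 + (1 - ε / 2) * ε ^ 4 := by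
      have : ε ^ 4 ≤ 1 := pow_le_one₀ hε.le hε1.le
      nlinarith
    nlinarith

end ReducedFlow

/-! ### Gradient of the population loss -/

section Gradient

variable {M : ℕ} (σ : Activation) (a : Fin M → Circle) (h : Feature)

/-- `A† h`, the coefficient vector of the overlap. -/
def adjointFeature : EuclideanSpace ℂ (Fin M) :=
  ContinuousLinearMap.adjoint (featureMap σ a) h

theorem overlap_eq_inner (w : EuclideanSpace ℂ (Fin M)) :
    overlap σ a h w = inner ℂ (adjointFeature σ a h) w := by
  rw [overlap, adjointFeature, ContinuousLinearMap.adjoint_inner_left]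

theorem inner_gram (w u : EuclideanSpace ℂ (Fin M)) :
    inner ℂ (featureMap σ a w) (featureMap σ a u) = inner ℂ (gram σ a w) u := by
  rw [gram, ContinuousLinearMap.comp_apply, ContinuousLinearMap.adjoint_inner_left]

theorem real_inner_eq_re (x y : Feature) : inner ℝ x y = (inner ℂ x y).re := by
  have h1 := norm_add_sq_real x y
  have h2 := norm_add_sq (𝕜 := ℂ) x y
  rw [RCLike.re_eq_complex_re] at h2
  linarith

/-- The population loss with the overall factor `|α_s|` removed. -/
def reducedLoss (s : ℕ) (w : EuclideanSpace ℂ (Fin M)) : ℝ :=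
  -(overlap σ a h w ^ s).re + 1 / 2 * (‖featureMap σ a w‖ ^ 2) ^ s

theorem hasDerivAt_reducedLoss (s : ℕ) (w u : EuclideanSpace ℂ (Fin M)) :
    HasDerivAt (fun t : ℝ => reducedLoss σ a h s (w + (t : ℂ) • u))
      (s * (inner ℂ u ((‖featureMap σ a w‖ ^ 2) ^ (s - 1) • gram σ a w
        - (starRingEnd ℂ) (overlap σ a h w) ^ (s - 1) • adjointFeature σ a h)).re) 0 := by
  have h0 : HasDerivAt (fun t : ℝ => w + (t : ℂ) • u) u 0 := by
    have h1 : HasDerivAt (fun t : ℝ => (t : ℂ)) 1 0 := Complex.ofRealCLM.hasDerivAt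
    simpa using (h1.smul_const u).const_add w
  have hA : HasDerivAt (fun t : ℝ => featureMap σ a (w + (t : ℂ) • u)) (featureMap σ a u) 0 :=
    ((featureMap σ a).restrictScalars ℝ).hasFDerivAt.comp_hasDerivAt 0 h0
  have hm : HasDerivAt (fun t : ℝ => overlap σ a h (w + (t : ℂ) • u)) (overlap σ a h u) 0 :=
    ((innerSL ℂ h).restrictScalars ℝ).hasFDerivAt.comp_hasDerivAt 0 hA
  have hre := (Complex.reCLM.hasFDerivAt.comp_hasDerivAt 0 (hm.pow s)).neg
  have hn := ((hA.norm_sq).pow s).const_mul (1 / 2)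
  refine (hre.add hn).congr_deriv ?_
  have hc : (starRingEnd ℂ) (overlap σ a h w) ^ (s - 1) = (starRingEnd ℂ) (overlap σ a h w ^ (s - 1)) :=
    (map_pow _ _ _).symm
  simp only [Complex.ofReal_zero, zero_smul, add_zero, Complex.reCLM_apply]
  rw [real_inner_eq_re, inner_gram, inner_sub_right, inner_smul_right, hc, inner_smul_right_eq_smul,
    ← inner_conj_symm u (gram σ a w), ← inner_conj_symm u (adjointFeature σ a h),
    ← overlap_eq_inner]
  generalize overlap σ a h w ^ (s - 1) = p
  generalize overlap σ a h u = q
  generalize inner ℂ (gram σ a w) u = r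
  generalize (‖featureMap σ a w‖ ^ 2) ^ (s - 1) = e
  simp
  ring

/-- The directional derivative along `u` is a multiple of `Re ⟨u, v⟩`; the directions `1` and `i` in
coordinate `m` extract the real and imaginary parts of `v m`. -/
theorem complexGrad_reducedLoss (c : ℝ) (s : ℕ) (w : EuclideanSpace ℂ (Fin M)) :
    complexGrad (fun w => c * reducedLoss σ a h s w) w
      = (c * s : ℝ) • ((‖featureMap σ a w‖ ^ 2) ^ (s - 1) • gram σ a w
        - (starRingEnd ℂ) (overlap σ a h w) ^ (s - 1) • adjointFeature σ a h) := by
  set v := (‖featureMap σ a w‖ ^ 2) ^ (s - 1) • gram σ a w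
        - (starRingEnd ℂ) (overlap σ a h w) ^ (s - 1) • adjointFeature σ a h with hv
  ext m
  have h1 : ∀ (z : ℂ) (t : ℝ), EuclideanSpace.single m (z * (t : ℂ))
      = (t : ℂ) • EuclideanSpace.single m z := fun z t => by
    ext i
    by_cases hi : i = m
    · subst hi
      simp [mul_comm]
    · simp [hi]
  have h2 := fun z : ℂ =>
    ((hasDerivAt_reducedLoss σ a h s w (EuclideanSpace.single m z)).const_mul c).deriv
  simp only [← hv, ← h1] at h2
  have h3 := h2 1
  have h4 := h2 Complex.I
  simp only [one_mul] at h3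
  simp only [complexGrad, h3, h4, EuclideanSpace.inner_single_left]
  apply Complex.ext <;> simp <;> ring

end Gradient

/-! ### The closed system along the flow -/

section Flow

variable {M : ℕ} {σ : Activation} {a : Fin M → Circle} {h : Feature}

/-- The normal equations: `h - A (A†A)⁻¹ A† h` is orthogonal to the range of `A`. -/
theorem featureMap_inverse_gram (hg : (gram σ a).IsInvertible) (h : Feature) :
    featureMap σ a ((gram σ a).inverse (adjointFeature σ a h))
      = ((featureMap σ a : EuclideanSpace ℂ (Fin M) →ₗ[ℂ] Feature).range).starProjection h := by
  refine (Submodule.eq_starProjection_of_mem_of_inner_eq_zero (LinearMap.mem_range_self _ _) ?_).symm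
  rintro _ ⟨u, rfl⟩
  simp only [ContinuousLinearMap.coe_coe]
  rw [inner_sub_left, inner_gram, hg.self_apply_inverse, ← overlap_eq_inner, overlap, sub_self]

theorem inner_featureMap_inverse_gram (hg : (gram σ a).IsInvertible)
    (w : EuclideanSpace ℂ (Fin M)) :
    inner ℂ (featureMap σ a w) (featureMap σ a ((gram σ a).inverse (adjointFeature σ a h)))
      = (starRingEnd ℂ) (overlap σ a h w) := by
  rw [← inner_conj_symm, inner_gram, hg.self_apply_inverse, overlap_eq_inner]

/-- Both sides are `‖P_A h‖²`. This is the only way the approximation error enters the dynamics. -/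
theorem overlap_inverse_gram (hg : (gram σ a).IsInvertible) :
    overlap σ a h ((gram σ a).inverse (adjointFeature σ a h))
      = ((1 - approxError σ a h : ℝ) : ℂ) := by
  have h1 := inner_featureMap_inverse_gram (h := h) hg
    ((gram σ a).inverse (adjointFeature σ a h))
  rw [inner_self_eq_norm_sq_to_K] at h1
  rw [approxError, sub_sub_cancel, ← featureMap_inverse_gram hg]
  have h2 := congrArg (starRingEnd ℂ) h1
  rw [Complex.conj_conj] at h2
  rw [← h2]
  simp

theorem approxError_nonneg (hh : ‖h‖ = 1) : 0 ≤ approxError σ a h := by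
  have h1 := Submodule.norm_starProjection_apply_le
    (featureMap σ a : EuclideanSpace ℂ (Fin M) →ₗ[ℂ] Feature).range h
  rw [hh] at h1
  have := pow_le_one₀ (n := 2) (norm_nonneg _) h1
  rw [approxError]
  linarith

theorem approxError_le_one : approxError σ a h ≤ 1 := by
  rw [approxError]
  linarith [sq_nonneg ‖((featureMap σ a : EuclideanSpace ℂ (Fin M) →ₗ[ℂ] Feature).range).starProjection h‖]

theorem residual_eq (hh : ‖h‖ = 1) (w : EuclideanSpace ℂ (Fin M)) :
    residual σ a h w = ‖featureMap σ a w‖ ^ 2 - radius σ a h w ^ 2 := by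
  have h1 := Submodule.norm_sq_eq_add_norm_sq_starProjection (featureMap σ a w)
    (Submodule.span ℂ {h})
  rw [Submodule.starProjection_singleton, norm_smul, hh] at h1
  rw [residual, radius, overlap, h1]
  simp

theorem radius_sq_le (hh : ‖h‖ = 1) (w : EuclideanSpace ℂ (Fin M)) :
    radius σ a h w ^ 2 ≤ ‖featureMap σ a w‖ ^ 2 := by
  have h1 := residual_eq (σ := σ) (a := a) hh w
  have h2 : 0 ≤ residual σ a h w := sq_nonneg _
  linarith

theorem cosPhase_mul (s : ℕ) (w : EuclideanSpace ℂ (Fin M)) :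
    cosPhase σ a s h w * radius σ a h w ^ s = (overlap σ a h w ^ s).re := by
  rw [cosPhase, radius]
  set m := overlap σ a h w
  conv_rhs => rw [← Complex.norm_mul_exp_arg_mul_I m]
  rw [mul_pow, ← Complex.exp_nat_mul, ← mul_assoc, ← Complex.ofReal_natCast, ← Complex.ofReal_mul,
    ← Complex.ofReal_pow, Complex.re_ofReal_mul, Complex.exp_ofReal_mul_I_re, mul_comm]

/-- The preconditioned velocity is `conj(m)^(s-1) e - ‖Aw‖^(2(s-1)) w` with `e = (A†A)⁻¹ A† h`. The
system closes because `⟨h, Ae⟩ = 1 - δ` and `⟨Aw, Ae⟩ = conj m` bring in no new quantity. -/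
theorem reducedFlow {N s : ℕ} {α : ℕ → ℂ} {w : ℝ → EuclideanSpace ℂ (Fin M)}
    (hs : 1 ≤ s) (hα : α s ≠ 0) (hh : ‖h‖ = 1) (hg : (gram σ a).IsInvertible)
    (hloss : loss N σ a α s h = fun w => ‖α s‖ * reducedLoss σ a h s w)
    (hw : IsPreconditionedFlow N σ a α s h w)
    (hr : 0 < radius σ a h (w 0)) (hc : 1 / 2 ≤ cosPhase σ a s h (w 0))
    (hv : residual σ a h (w 0) = 1 - radius σ a h (w 0) ^ 2) :
    ReducedFlow s (1 - approxError σ a h) (fun t => radius σ a h (w t) ^ 2)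
      (fun t => ‖featureMap σ a (w t)‖ ^ 2) (fun t => (overlap σ a h (w t) ^ s).re)
      (fun t => (overlap σ a h (w t) ^ s).im) := by
  set δ := approxError σ a h
  set e := (gram σ a).inverse (adjointFeature σ a h) with he
  have hw' : ∀ t, 0 ≤ t → HasDerivWithinAt w
      ((starRingEnd ℂ) (overlap σ a h (w t)) ^ (s - 1) • e
        - (‖featureMap σ a (w t)‖ ^ 2) ^ (s - 1) • w t) (Ici 0) t := by
    intro t ht
    refine (hw t ht).congr_deriv ?_
    rw [hloss, complexGrad_reducedLoss]
    have h1 : (1 / (s * ‖α s‖)) * (‖α s‖ * s) = 1 := by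
      have : (0 : ℝ) < s := by exact_mod_cast hs
      have := norm_ne_zero_iff.2 hα
      field_simp
    rw [ContinuousLinearMap.map_smul_of_tower, smul_smul, h1, one_smul, map_sub,
      ContinuousLinearMap.map_smul_of_tower, map_smul,
      hg.inverse_apply_self, neg_sub]
  have hA : ∀ t, 0 ≤ t → HasDerivWithinAt (fun t => featureMap σ a (w t))
      ((starRingEnd ℂ) (overlap σ a h (w t)) ^ (s - 1) • featureMap σ a e
        - (‖featureMap σ a (w t)‖ ^ 2) ^ (s - 1) • featureMap σ a (w t)) (Ici 0) t := by
    intro t ht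
    refine (((featureMap σ a).restrictScalars ℝ).hasFDerivAt.comp_hasDerivWithinAt t
      (hw' t ht)).congr_deriv ?_
    simp
  have hm : ∀ t, 0 ≤ t → HasDerivWithinAt (fun t => overlap σ a h (w t))
      ((starRingEnd ℂ) (overlap σ a h (w t)) ^ (s - 1) * ((1 - δ : ℝ) : ℂ)
        - (((‖featureMap σ a (w t)‖ ^ 2) ^ (s - 1) : ℝ) : ℂ) * overlap σ a h (w t)) (Ici 0) t := by
    intro t ht
    refine (((innerSL ℂ h).restrictScalars ℝ).hasFDerivAt.comp_hasDerivWithinAt t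
      (hA t ht)).congr_deriv ?_
    rw [← overlap_inverse_gram hg]
    simp [overlap, he, inner_sub_right, inner_smul_right, inner_smul_right_eq_smul]
  have hpow : ∀ t, 0 ≤ t → HasDerivWithinAt (fun t => overlap σ a h (w t) ^ s)
      ((s : ℂ) * (((1 - δ) * (radius σ a h (w t) ^ 2) ^ (s - 1) : ℝ)
        - (((‖featureMap σ a (w t)‖ ^ 2) ^ (s - 1) : ℝ) : ℂ) * overlap σ a h (w t) ^ s))
      (Ici 0) t := by
    intro t ht
    refine ((hm t ht).pow s).congr_deriv ?_
    have h1 : (((radius σ a h (w t) ^ 2) ^ (s - 1) : ℝ) : ℂ)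
        = overlap σ a h (w t) ^ (s - 1) * (starRingEnd ℂ) (overlap σ a h (w t)) ^ (s - 1) := by
      rw [← mul_pow, Complex.mul_conj', radius]
      push_cast
      rfl
    obtain ⟨k, rfl⟩ : ∃ k, s = k + 1 := ⟨s - 1, by omega⟩
    rw [Complex.ofReal_mul, h1, pow_succ (overlap σ a h (w t)) k]
    simp only [Nat.add_sub_cancel, pow_succ]
    ring
  refine ⟨hs, ?_, ?_, ?_, ?_, ?_, ?_, ?_, ?_, ?_, ?_, ?_, ?_⟩
  · linarith [approxError_le_one (σ := σ) (a := a) (h := h)]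
  · linarith [approxError_nonneg (σ := σ) (a := a) hh]
  · intro t ht
    refine ((hm t ht).norm_sq).congr_deriv ?_
    have h1 : (overlap σ a h (w t) ^ s).re
        = ((starRingEnd ℂ) (overlap σ a h (w t)) ^ (s - 1)
          * (starRingEnd ℂ) (overlap σ a h (w t))).re := by
      rw [← pow_succ, Nat.sub_add_cancel hs, ← map_pow, Complex.conj_re]
    have h2 : ‖overlap σ a h (w t)‖ ^ 2
        = (overlap σ a h (w t)).re ^ 2 + (overlap σ a h (w t)).im ^ 2 := by
      rw [Complex.sq_norm, Complex.normSq_apply]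
      ring
    rw [h1, Complex.inner, radius, h2]
    generalize (starRingEnd ℂ) (overlap σ a h (w t)) ^ (s - 1) = p
    generalize (‖featureMap σ a (w t)‖ ^ 2) ^ (s - 1) = q
    simp
    ring
  · intro t ht
    refine ((hA t ht).norm_sq).congr_deriv ?_
    have h1 : (overlap σ a h (w t) ^ s).re
        = ((starRingEnd ℂ) (overlap σ a h (w t)) ^ (s - 1)
          * (starRingEnd ℂ) (overlap σ a h (w t))).re := by
      rw [← pow_succ, Nat.sub_add_cancel hs, ← map_pow, Complex.conj_re]
    have h2 : (‖featureMap σ a (w t)‖ ^ 2) ^ s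
        = (‖featureMap σ a (w t)‖ ^ 2) ^ (s - 1) * ‖featureMap σ a (w t)‖ ^ 2 := by
      rw [← pow_succ, Nat.sub_add_cancel hs]
    rw [h1, h2, real_inner_eq_re, inner_sub_right, inner_smul_right, inner_smul_right_eq_smul,
      he, inner_featureMap_inverse_gram hg, inner_self_eq_norm_sq_to_K]
    simp [← Complex.ofReal_pow]
  · intro t ht
    refine (Complex.reCLM.hasFDerivAt.comp_hasDerivWithinAt t (hpow t ht)).congr_deriv ?_
    simp [-Complex.ofReal_pow, -Complex.ofReal_mul]
  · intro t ht
    refine (Complex.imCLM.hasFDerivAt.comp_hasDerivWithinAt t (hpow t ht)).congr_deriv ?_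
    simp [-Complex.ofReal_pow, -Complex.ofReal_mul]
  · exact fun t _ => sq_nonneg _
  · exact fun t _ => radius_sq_le hh _
  · intro t _
    rw [← pow_mul, mul_comm 2 s, pow_mul, radius, ← norm_pow, Complex.sq_norm, Complex.normSq_apply]
    ring
  · have := residual_eq (σ := σ) (a := a) hh (w 0)
    linarith
  · rw [← cosPhase_mul]
    positivity
  -- `cos sθ₀ ≥ 1/2` means `r^s ≤ 2x`, hence `y² = r^(2s) - x² ≤ 3x²`.
  · have h1 := cosPhase_mul (σ := σ) (a := a) (h := h) s (w 0)
    have h2 : (overlap σ a h (w 0) ^ s).re ^ 2 + (overlap σ a h (w 0) ^ s).im ^ 2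
        = (radius σ a h (w 0) ^ s) ^ 2 := by
      rw [radius, ← norm_pow, Complex.sq_norm, Complex.normSq_apply]
      ring
    have h3 := pow_pos hr s
    have h4 : radius σ a h (w 0) ^ s ≤ 2 * (overlap σ a h (w 0) ^ s).re := by nlinarith
    nlinarith

end Flow

end DeepSets

namespace DeepSets

open MvPolynomial

/-! ### Moments on the torus -/

theorem measurable_toCircle :
    Measurable fun θ : AddCircle (1 : ℝ) => (AddCircle.toCircle θ : ℂ) :=
  (continuous_subtype_val.comp AddCircle.continuous_toCircle).measurable

instance : IsProbabilityMeasure unitCircleMeasure :=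
  Measure.isProbabilityMeasure_map measurable_toCircle.aemeasurable

theorem ae_norm_eq_one : ∀ᵐ z ∂unitCircleMeasure, ‖z‖ = 1 := by
  rw [unitCircleMeasure, ae_map_iff measurable_toCircle.aemeasurable (measurableSet_eq_fun (by fun_prop) (by fun_prop))]
  exact Filter.Eventually.of_forall fun θ => Circle.norm_coe _

theorem integral_pow_mul_conj_pow (a b : ℕ) :
    ∫ z, z ^ a * (starRingEnd ℂ) z ^ b ∂unitCircleMeasure = if a = b then 1 else 0 := by
  rw [unitCircleMeasure, integral_map measurable_toCircle.aemeasurable (by fun_prop)]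
  have h : ∀ θ : AddCircle (1 : ℝ), (AddCircle.toCircle θ : ℂ) ^ a
      * (starRingEnd ℂ) (AddCircle.toCircle θ : ℂ) ^ b = fourier ((a : ℤ) - b) θ := by
    intro θ
    rw [sub_eq_add_neg, fourier_add, fourier_neg]
    simp [fourier_apply, AddCircle.toCircle_nsmul]
  simp_rw [h]
  split_ifs with hab
  · simp [hab]
  · exact integral_eq_zero_of_add_right_eq_neg
      (fourier_add_half_inv_index (sub_ne_zero.2 (by exact_mod_cast hab)) one_pos)

/-- The uniform distribution on the torus. -/
abbrev torusMeasure (N : ℕ) : Measure (Fin N → ℂ) := Measure.pi fun _ => unitCircleMeasure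

theorem ae_torus (N : ℕ) : ∀ᵐ x ∂torusMeasure N, ∀ n, ‖x n‖ = 1 :=
  Filter.eventually_all.2 fun n =>
    (Measure.tendsto_eval_ae_ae (μ := fun _ : Fin N => unitCircleMeasure) (i := n)).eventually
      ae_norm_eq_one

/-- Polynomials in the coordinates `x_n` (`inl n`) and their inverses (`inr n`). -/
abbrev TorusPoly (N : ℕ) : Type := MvPolynomial (Fin N ⊕ Fin N) ℂ

/-- Evaluation of a polynomial at `(x, conj x)`. -/
def evTorus {N : ℕ} (x : Fin N → ℂ) : TorusPoly N →ₐ[ℂ] ℂ :=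
  aeval (Sum.elim x fun n => (starRingEnd ℂ) (x n))

section Torus

variable {N : ℕ}

@[simp] theorem evTorus_inl (x : Fin N → ℂ) (n : Fin N) : evTorus x (X (Sum.inl n)) = x n := by
  simp [evTorus]

@[simp] theorem evTorus_inr (x : Fin N → ℂ) (n : Fin N) :
    evTorus x (X (Sum.inr n)) = (starRingEnd ℂ) (x n) := by
  simp [evTorus]

theorem continuous_evTorus (F : TorusPoly N) : Continuous fun x : Fin N → ℂ => evTorus x F := by
  induction F using MvPolynomial.induction_on with
  | C a => simpa [evTorus] using continuous_const
  | add p q hp hq => simpa using! hp.add hq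
  | mul_X p i hp =>
    rcases i with n | n
    · simpa using! hp.mul (continuous_apply n)
    · simpa using! hp.mul (Complex.continuous_conj.comp (continuous_apply n))

theorem integrable_torus {f : (Fin N → ℂ) → ℂ} (hf : Continuous f) :
    Integrable f (torusMeasure N) := by
  obtain ⟨C, hC⟩ := (isCompact_closedBall (0 : Fin N → ℂ) 1).exists_bound_of_continuousOn
    hf.continuousOn
  refine Integrable.of_bound hf.aestronglyMeasurable C ?_
  filter_upwards [ae_torus N] with x hx
  refine hC x ?_
  rw [mem_closedBall_zero_iff, pi_norm_le_iff_of_nonneg zero_le_one]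
  exact fun n => (hx n).le

/-- The uniform expectation on the torus. -/
def torusMean (N : ℕ) : TorusPoly N →ₗ[ℂ] ℂ where
  toFun F := ∫ x, evTorus x F ∂torusMeasure N
  map_add' F G := by
    simp only [map_add]
    exact integral_add (integrable_torus (continuous_evTorus F))
      (integrable_torus (continuous_evTorus G))
  map_smul' c F := by
    simp only [map_smul, smul_eq_mul, RingHom.id_apply]
    exact integral_const_mul _ _

theorem torusMean_apply (F : TorusPoly N) :
    torusMean N F = ∫ x, evTorus x F ∂torusMeasure N := rfl

theorem torusMean_congr {F G : TorusPoly N}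
    (h : ∀ x : Fin N → ℂ, (∀ n, ‖x n‖ = 1) → evTorus x F = evTorus x G) :
    torusMean N F = torusMean N G := by
  refine integral_congr_ae ?_
  filter_upwards [ae_torus N] with x hx using h x hx

theorem torusMean_prod (a b : Fin N → ℕ) :
    torusMean N (∏ n, X (Sum.inl n) ^ a n * X (Sum.inr n) ^ b n) = if a = b then 1 else 0 := by
  simp only [torusMean_apply, map_prod, map_mul, map_pow, evTorus_inl, evTorus_inr]
  rw [integral_fintype_prod_eq_prod (f := fun n (z : ℂ) => z ^ a n * (starRingEnd ℂ) z ^ b n)]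
  simp_rw [integral_pow_mul_conj_pow]
  rw [Finset.prod_ite_zero]
  simp [funext_iff]

/-! ### Integration by parts -/

/-- If each factor of a product is an eigenvector of a derivation, so is the product. -/
theorem derivation_prod_eigen {A B ι : Type*} [CommRing A] [Algebra ℂ A] [CommRing B]
    (D : Derivation ℂ A A) (e : A →+* B) (q : ι → A) (γ : ι → B) (S : Finset ι)
    (h : ∀ i ∈ S, e (D (q i)) = γ i * e (q i)) :
    e (D (∏ i ∈ S, q i)) = (∑ i ∈ S, γ i) * e (∏ i ∈ S, q i) := by
  classical
  induction S using Finset.induction_on with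
  | empty => simp
  | insert i S hi ih =>
    rw [Finset.prod_insert hi, Finset.sum_insert hi, Derivation.leibniz, smul_eq_mul, smul_eq_mul,
      map_add, map_mul, map_mul, ih fun j hj => h j (Finset.mem_insert_of_mem hj),
      h i (Finset.mem_insert_self i S), map_mul]
    ring

theorem derivation_pow_eigen {A B : Type*} [CommRing A] [Algebra ℂ A] [CommRing B]
    (D : Derivation ℂ A A) (e : A →+* B) (q : A) (γ : B) (h : e (D q) = γ * e q) (k : ℕ) :
    e (D (q ^ k)) = k * γ * e (q ^ k) := by
  have := derivation_prod_eigen D e (fun _ : Fin k => q) (fun _ => γ) Finset.univ fun _ _ => h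
  simpa using this

/-- The derivation `x_n ∂/∂x_n` on the torus. -/
def angularDeriv (n : Fin N) : Derivation ℂ (TorusPoly N) (TorusPoly N) :=
  mkDerivation ℂ (Sum.elim (Pi.single n (X (Sum.inl n))) (Pi.single n (-X (Sum.inr n))))

/-- Each monomial is an eigenvector whose eigenvalue is the difference of its exponents in `x_n` and
its conjugate; unless that difference is zero, the mean of the monomial vanishes. -/
theorem torusMean_angularDeriv (n : Fin N) (F : TorusPoly N) :
    torusMean N (angularDeriv n F) = 0 := by
  suffices h : torusMean N ∘ₗ (angularDeriv n).toLinearMap = 0 from LinearMap.congr_fun h F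
  refine MvPolynomial.linearMap_ext fun s => LinearMap.ext_ring ?_
  have hs : (monomial s (1 : ℂ) : TorusPoly N)
      = ∏ m, X (Sum.inl m) ^ s (Sum.inl m) * X (Sum.inr m) ^ s (Sum.inr m) := by
    rw [monomial_eq, C_1, one_mul, Finsupp.prod_fintype _ _ fun _ => pow_zero _,
      Fintype.prod_sum_type, Finset.prod_mul_distrib]
  have h0 : angularDeriv n (monomial s (1 : ℂ)) = ((s (Sum.inl n) : ℂ) - s (Sum.inr n)) •
      (monomial s (1 : ℂ) : TorusPoly N) := by
    have h1 := derivation_prod_eigen (angularDeriv n) (RingHom.id _)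
      (fun i => X i ^ s i) (fun i => (s i : TorusPoly N) *
        Sum.elim (Pi.single n 1) (Pi.single n (-1)) i) Finset.univ fun i _ => by
        refine derivation_pow_eigen _ (RingHom.id _) _ _ ?_ _
        rw [angularDeriv, RingHom.id_apply, mkDerivation_X]
        rcases i with m | m
        · by_cases hm : m = n
          · subst hm; simp
          · simp [hm]
        · by_cases hm : m = n
          · subst hm; simp
          · simp [hm]
    have h2 : (monomial s (1 : ℂ) : TorusPoly N) = ∏ i, X i ^ s i := by
      rw [monomial_eq, C_1, one_mul, Finsupp.prod_fintype _ _ fun _ => pow_zero _]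
    rw [h2]
    refine h1.trans ?_
    rw [RingHom.id_apply, Fintype.sum_sum_type]
    simp [Pi.single_apply, smul_eq_C_mul, sub_eq_add_neg]
  simp only [LinearMap.coe_comp, Function.comp_apply, LinearMap.zero_apply]
  change torusMean N (angularDeriv n (monomial s (1 : ℂ))) = 0
  rw [h0, map_smul, hs, torusMean_prod, smul_eq_mul]
  split_ifs with h
  · have := congrFun h n
    simp [this]
  · simp

end Torus

/-! ### The Vandermonde weight and its loop equations -/

section Weight

variable {N : ℕ}

/-- `(x_i - x_j) (x_i⁻¹ - x_j⁻¹)`. -/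
def weightFactor (i j : Fin N) : TorusPoly N :=
  (X (Sum.inl i) - X (Sum.inl j)) * (X (Sum.inr i) - X (Sum.inr j))

/-- The polynomial representing `∏_{i < j} |x_i - x_j|²`. -/
def vandermondeWeight (N : ℕ) : TorusPoly N :=
  ∏ i : Fin N, ∏ j ∈ Finset.Ioi i, weightFactor i j

theorem evTorus_vandermondeWeight (x : Fin N → ℂ) :
    evTorus x (vandermondeWeight N)
      = ((∏ i : Fin N, ∏ j ∈ Finset.Ioi i, ‖x i - x j‖ ^ 2 : ℝ) : ℂ) := by
  simp only [vandermondeWeight, weightFactor, map_prod, map_mul, map_sub, evTorus_inl, evTorus_inr]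
  push_cast
  refine Finset.prod_congr rfl fun i _ => Finset.prod_congr rfl fun j _ => ?_
  rw [← map_sub, Complex.mul_conj']

/-- The weight is a product of two Vandermonde determinants; orthogonality of monomials keeps only
the `N!` pairs of equal permutations. -/
theorem torusMean_vandermondeWeight : torusMean N (vandermondeWeight N) = N.factorial := by
  have h1 : vandermondeWeight N = (Matrix.vandermonde fun n : Fin N => (X (Sum.inl n) : TorusPoly N)).det
      * (Matrix.vandermonde fun n : Fin N => (X (Sum.inr n) : TorusPoly N)).det := by
    rw [Matrix.det_vandermonde, Matrix.det_vandermonde, ← Finset.prod_mul_distrib]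
    refine Finset.prod_congr rfl fun i _ => ?_
    rw [← Finset.prod_mul_distrib]
    refine Finset.prod_congr rfl fun j _ => ?_
    rw [weightFactor]
    ring
  have h2 : ∀ v : Fin N → TorusPoly N, (Matrix.vandermonde v).det
      = ∑ τ : Equiv.Perm (Fin N), ((Equiv.Perm.sign τ : ℤ) : ℂ) • ∏ n, v n ^ (τ n : ℕ) := by
    intro v
    rw [← Matrix.det_transpose, Matrix.det_apply']
    refine Finset.sum_congr rfl fun τ _ => ?_
    simp [Matrix.vandermonde, smul_eq_C_mul]
  rw [h1, h2, h2, Finset.sum_mul_sum, map_sum]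
  have h3 : ∀ τ ρ : Equiv.Perm (Fin N), torusMean N
      ((((Equiv.Perm.sign τ : ℤ) : ℂ) • ∏ n, (X (Sum.inl n) : TorusPoly N) ^ (τ n : ℕ)) *
        (((Equiv.Perm.sign ρ : ℤ) : ℂ) • ∏ n, (X (Sum.inr n) : TorusPoly N) ^ (ρ n : ℕ)))
      = if τ = ρ then 1 else 0 := by
    intro τ ρ
    rw [smul_mul_smul_comm, ← Finset.prod_mul_distrib, map_smul, torusMean_prod]
    have h4 : ((fun n => (τ n : ℕ)) = fun n => (ρ n : ℕ)) ↔ τ = ρ := by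
      simp [funext_iff, Fin.val_inj, Equiv.ext_iff]
    simp only [h4]
    split_ifs with h
    · subst h
      rw [← Int.cast_mul, ← Units.val_mul, Int.units_mul_self]
      simp
    · simp
  simp only [map_sum, h3]
  simp [Fintype.card_perm]

/-- The power sums `∑ₙ xₙ^k`. -/
def psum (k : ℕ) : TorusPoly N := ∑ n, X (Sum.inl n) ^ k

/-- The conjugate power sums `∑ₙ xₙ^{-k}`. -/
def psumConj (k : ℕ) : TorusPoly N := ∑ n, X (Sum.inr n) ^ k

/-- The derivation `∑ₙ xₙ^{k+1} ∂/∂xₙ` on the torus. -/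
def shiftDeriv (k : ℕ) : Derivation ℂ (TorusPoly N) (TorusPoly N) :=
  mkDerivation ℂ (Sum.elim (fun n => X (Sum.inl n) ^ (k + 1))
    (fun n => -(X (Sum.inl n) ^ k * X (Sum.inr n))))

theorem shiftDeriv_eq_sum (k : ℕ) (F : TorusPoly N) :
    shiftDeriv k F = ∑ n, X (Sum.inl n) ^ k * angularDeriv n F := by
  have hsum : ∀ (D : Fin N → Derivation ℂ (TorusPoly N) (TorusPoly N)) (F : TorusPoly N),
      (∑ n, D n) F = ∑ n, D n F := fun D F => by
    change Derivation.coeFnAddMonoidHom _ F = _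
    rw [map_sum, Finset.sum_apply]
    rfl
  have h : shiftDeriv k = ∑ n : Fin N, (X (Sum.inl n) : TorusPoly N) ^ k • angularDeriv n := by
    refine derivation_ext fun i => ?_
    rw [shiftDeriv, mkDerivation_X, hsum]
    rcases i with m | m
    · simp [angularDeriv, mkDerivation_X, Pi.single_apply, pow_succ]
    · simp [angularDeriv, mkDerivation_X, Pi.single_apply]
  rw [h, hsum]
  rfl

/-- The argument is the total derivative `∑ₙ xₙ ∂/∂xₙ (xₙ^k F)`; the term `k psum k` is the
divergence of the vector field. -/
theorem torusMean_shiftDeriv (k : ℕ) (F : TorusPoly N) :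
    torusMean N ((k : TorusPoly N) * psum k * F + shiftDeriv k F) = 0 := by
  have h : (k : TorusPoly N) * psum k * F + shiftDeriv k F
      = ∑ n : Fin N, angularDeriv n (X (Sum.inl n) ^ k * F) := by
    rw [shiftDeriv_eq_sum, psum, Finset.mul_sum, Finset.sum_mul, ← Finset.sum_add_distrib]
    refine Finset.sum_congr rfl fun n _ => ?_
    have h1 := derivation_pow_eigen (angularDeriv n) (RingHom.id _) (X (Sum.inl n)) 1
      (by simp [angularDeriv, mkDerivation_X]) k
    simp only [RingHom.id_apply, mul_one] at h1
    rw [Derivation.leibniz, h1, smul_eq_mul, smul_eq_mul]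
    ring
  rw [h, map_sum]
  exact Finset.sum_eq_zero fun n _ => torusMean_angularDeriv n _

theorem conj_mul_self {z : ℂ} (h : ‖z‖ = 1) : (starRingEnd ℂ) z * z = 1 := by
  rw [Complex.conj_mul', h]
  norm_num

/-- The logarithmic derivative of a factor of the weight along `shiftDeriv k`. -/
def logDerivFactor (k : ℕ) (u v : ℂ) : ℂ :=
  (∑ a ∈ Finset.range k, u ^ a * v ^ (k - 1 - a)) * (u + v)

theorem evTorus_shiftDeriv_weightFactor (k : ℕ) {x : Fin N → ℂ} (hx : ∀ n, ‖x n‖ = 1)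
    (i j : Fin N) : evTorus x (shiftDeriv k (weightFactor i j))
      = logDerivFactor k (x i) (x j) * evTorus x (weightFactor i j) := by
  have h := Commute.geom_sum₂_mul (Commute.all (x i) (x j)) k
  have hi := conj_mul_self (hx i)
  have hj := conj_mul_self (hx j)
  simp only [weightFactor, shiftDeriv, logDerivFactor, Derivation.leibniz, map_sub, mkDerivation_X,
    Sum.elim_inl, Sum.elim_inr, smul_eq_mul, map_add, map_mul, map_pow, map_neg, evTorus_inl,
    evTorus_inr]
  generalize (∑ a ∈ Finset.range k, x i ^ a * x j ^ (k - 1 - a)) = S at *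
  generalize (starRingEnd ℂ) (x i) = y at *
  generalize (starRingEnd ℂ) (x j) = z at *
  generalize x i = u at *
  generalize x j = v at *
  have e : u ^ k = S * (u - v) + v ^ k := by rw [h]; ring
  rw [pow_succ, pow_succ, e]
  linear_combination S * (u - v) * (hj - hi)

/-- `logDerivFactor` is symmetric, so the sum over `i < j` is half of the full double sum minus its
diagonal `2k xᵢ^k`. Reflecting `a` shows that the full sum is two copies of the right-hand side. -/
theorem sum_Ioi_logDerivFactor (k : ℕ) (x : Fin N → ℂ) :
    ∑ i, ∑ j ∈ Finset.Ioi i, logDerivFactor k (x i) (x j) + k * ∑ n, x n ^ k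
      = ∑ a ∈ Finset.range k, (∑ n, x n ^ a) * ∑ n, x n ^ (k - a) := by
  have hsymm : ∀ u v, logDerivFactor k u v = logDerivFactor k v u := by
    intro u v
    rw [logDerivFactor, logDerivFactor, add_comm u v, ← Finset.sum_range_reflect]
    congr 1
    refine Finset.sum_congr rfl fun a ha => ?_
    rw [Finset.mem_range] at ha
    rw [mul_comm, show k - 1 - (k - 1 - a) = a by omega]
  have hdiag : ∀ u, logDerivFactor k u u = 2 * (k * u ^ k) := by
    intro u
    rcases k with _ | k
    · simp [logDerivFactor]
    have : ∀ a ∈ Finset.range (k + 1), u ^ a * u ^ (k + 1 - 1 - a) = u ^ k := fun a ha => by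
      rw [Finset.mem_range] at ha
      rw [← pow_add]
      congr 1
      omega
    rw [logDerivFactor, Finset.sum_congr rfl this]
    simp
    ring
  have hfull : ∑ i, ∑ j, logDerivFactor k (x i) (x j)
      = 2 * ∑ a ∈ Finset.range k, (∑ n, x n ^ a) * ∑ n, x n ^ (k - a) := by
    have h1 : ∀ i j, logDerivFactor k (x i) (x j)
        = ∑ a ∈ Finset.range k, x i ^ (a + 1) * x j ^ (k - 1 - a)
          + ∑ a ∈ Finset.range k, x i ^ a * x j ^ (k - a) := fun i j => by
      rw [logDerivFactor, mul_add, Finset.sum_mul, Finset.sum_mul]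
      congr 1
      · exact Finset.sum_congr rfl fun a _ => by ring
      · refine Finset.sum_congr rfl fun a ha => ?_
        rw [Finset.mem_range] at ha
        rw [mul_assoc, ← pow_succ, show k - 1 - a + 1 = k - a by omega]
    have h2 : ∀ p q : ℕ → ℕ, ∑ i, ∑ j, ∑ a ∈ Finset.range k, x i ^ p a * x j ^ q a
        = ∑ a ∈ Finset.range k, (∑ n, x n ^ p a) * ∑ n, x n ^ q a := fun p q => by
      simp only [Finset.sum_mul_sum]
      rw [Finset.sum_comm]
      simp only [Finset.sum_comm (s := Finset.univ) (t := Finset.range k)]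
      exact Finset.sum_congr rfl fun a _ => Finset.sum_comm
    simp only [h1, Finset.sum_add_distrib]
    rw [h2 (fun a => a + 1) (fun a => k - 1 - a), h2 (fun a => a) (fun a => k - a), two_mul]
    congr 1
    rw [← Finset.sum_range_reflect]
    refine Finset.sum_congr rfl fun a ha => ?_
    rw [Finset.mem_range] at ha
    rw [mul_comm, show k - 1 - (k - 1 - a) = a by omega, show k - 1 - a + 1 = k - a by omega]
  have hsplit : ∑ i, ∑ j, logDerivFactor k (x i) (x j)
      = ∑ i, ∑ j ∈ Finset.Ioi i, logDerivFactor k (x i) (x j)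
        + ∑ i, ∑ j ∈ Finset.Iio i, logDerivFactor k (x i) (x j)
        + ∑ i, logDerivFactor k (x i) (x i) := by
    rw [← Finset.sum_add_distrib, ← Finset.sum_add_distrib]
    refine Finset.sum_congr rfl fun i _ => ?_
    have h1 := Finset.sum_ite_eq' Finset.univ i fun j => logDerivFactor k (x i) (x j)
    rw [if_pos (Finset.mem_univ i)] at h1
    rw [← Finset.filter_lt_eq_Ioi, ← Finset.filter_gt_eq_Iio, Finset.sum_filter, Finset.sum_filter,
      ← h1, ← Finset.sum_add_distrib, ← Finset.sum_add_distrib]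
    refine Finset.sum_congr rfl fun j _ => ?_
    rcases lt_trichotomy i j with hij | rfl | hij
    · simp [hij, hij.ne', hij.not_gt]
    · simp
    · simp [hij, hij.ne, hij.not_gt]
  have hswap : ∑ i, ∑ j ∈ Finset.Iio i, logDerivFactor k (x i) (x j)
      = ∑ i, ∑ j ∈ Finset.Ioi i, logDerivFactor k (x i) (x j) := by
    rw [Finset.sum_comm' (t' := Finset.univ) (s' := fun j => Finset.Ioi j) (by simp)]
    exact Finset.sum_congr rfl fun i _ => Finset.sum_congr rfl fun j _ => hsymm _ _
  simp only [hfull, hswap, hdiag, ← Finset.mul_sum] at hsplit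
  linear_combination -hsplit / 2

theorem evTorus_shiftDeriv_vandermondeWeight (k : ℕ) {x : Fin N → ℂ} (hx : ∀ n, ‖x n‖ = 1) :
    evTorus x ((k : TorusPoly N) * psum k * vandermondeWeight N + shiftDeriv k (vandermondeWeight N))
      = evTorus x ((∑ a ∈ Finset.range k, psum a * psum (k - a)) * vandermondeWeight N) := by
  have h1 : ∀ i : Fin N, evTorus x (shiftDeriv k (∏ j ∈ Finset.Ioi i, weightFactor i j))
      = (∑ j ∈ Finset.Ioi i, logDerivFactor k (x i) (x j))
        * evTorus x (∏ j ∈ Finset.Ioi i, weightFactor i j) := fun i =>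
    derivation_prod_eigen (shiftDeriv k) (evTorus x).toRingHom _ _ _
      fun j _ => evTorus_shiftDeriv_weightFactor k hx i j
  have h2 : evTorus x (shiftDeriv k (vandermondeWeight N)) = _ * evTorus x (vandermondeWeight N) :=
    derivation_prod_eigen (shiftDeriv k) (evTorus x).toRingHom _ _ Finset.univ fun i _ => h1 i
  have h3 : ∀ a, evTorus x (psum a) = ∑ n, x n ^ a := fun a => by simp [psum]
  rw [map_add, map_mul, h2, map_mul, map_mul, map_sum, map_natCast, h3]
  simp only [map_mul, h3]
  rw [← sum_Ioi_logDerivFactor]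
  ring

/-- The expectation of a polynomial in `x`, `x⁻¹` under the Vandermonde distribution. -/
def vandermondeMean (N : ℕ) : TorusPoly N →ₗ[ℂ] ℂ :=
  (1 / (N.factorial : ℂ)) • torusMean N ∘ₗ LinearMap.mulLeft ℂ (vandermondeWeight N)

theorem vandermondeMean_apply (F : TorusPoly N) : vandermondeMean N F
    = (1 / (N.factorial : ℂ)) * torusMean N (vandermondeWeight N * F) := rfl

theorem vandermondeMean_one : vandermondeMean N 1 = 1 := by
  rw [vandermondeMean_apply, mul_one, torusMean_vandermondeWeight]
  have : (N.factorial : ℂ) ≠ 0 := by exact_mod_cast N.factorial_ne_zero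
  field_simp

theorem vandermondeMean_congr {F G : TorusPoly N}
    (h : ∀ x : Fin N → ℂ, (∀ n, ‖x n‖ = 1) → evTorus x F = evTorus x G) :
    vandermondeMean N F = vandermondeMean N G := by
  rw [vandermondeMean_apply, vandermondeMean_apply]
  congr 1
  exact torusMean_congr fun x hx => by rw [map_mul, map_mul, h x hx]

/-- The loop (Schwinger–Dyson) equations of the circular unitary ensemble. -/
theorem vandermondeMean_loop (k : ℕ) (G : TorusPoly N) :
    vandermondeMean N ((∑ a ∈ Finset.range k, psum a * psum (k - a)) * G + shiftDeriv k G) = 0 := by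
  rw [vandermondeMean_apply, ← mul_zero (1 / (N.factorial : ℂ)),
    ← torusMean_shiftDeriv k (vandermondeWeight N * G)]
  congr 1
  refine torusMean_congr fun x hx => ?_
  have h := evTorus_shiftDeriv_vandermondeWeight k hx
  rw [Derivation.leibniz, smul_eq_mul, smul_eq_mul]
  simp only [map_add, map_mul] at h ⊢
  linear_combination -evTorus x G * h

theorem integral_evTorus (F : TorusPoly N) :
    ∫ x, evTorus x F ∂vandermondeMeasure N = vandermondeMean N F := by
  have hm : Measurable fun x : Fin N → ℂ => ENNReal.ofReal
      ((1 / (N.factorial : ℝ)) * ∏ i : Fin N, ∏ j ∈ Finset.Ioi i, ‖x i - x j‖ ^ 2) := by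
    fun_prop
  rw [vandermondeMeasure, integral_withDensity_eq_integral_toReal_smul hm
    (Filter.Eventually.of_forall fun _ => ENNReal.ofReal_lt_top), vandermondeMean_apply,
    torusMean_apply, ← integral_const_mul]
  refine integral_congr_ae (Filter.Eventually.of_forall fun x => ?_)
  have h0 : 0 ≤ (1 / (N.factorial : ℝ)) * ∏ i : Fin N, ∏ j ∈ Finset.Ioi i, ‖x i - x j‖ ^ 2 := by
    positivity
  simp only [ENNReal.toReal_ofReal h0, map_mul, evTorus_vandermondeWeight]
  rw [Complex.real_smul]
  push_cast
  ring

end Weight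

/-! ### Adjointness of multiplication and differentiation for power sums -/

/-- Polynomials in the power sums; the variable `X k` stands for `∑ₙ xₙ^k`. -/
abbrev PsumPoly : Type := MvPolynomial ℕ ℂ

section Pairing

variable (N : ℕ)

/-- Substitution of the power sums. -/
def psumSubst : PsumPoly →ₐ[ℂ] TorusPoly N := aeval psum

/-- Substitution of the conjugate power sums. -/
def psumConjSubst : PsumPoly →ₐ[ℂ] TorusPoly N := aeval psumConj

@[simp] theorem psumSubst_X (k : ℕ) : psumSubst N (X k) = psum k := by simp [psumSubst]

@[simp] theorem psumConjSubst_X (k : ℕ) : psumConjSubst N (X k) = psumConj k := by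
  simp [psumConjSubst]

/-- The bilinear pairing `(f, g) ↦ 𝔼[f(p(x)) g(p(x⁻¹))]`. -/
def psumPair : PsumPoly →ₗ[ℂ] PsumPoly →ₗ[ℂ] ℂ :=
  ((LinearMap.mul ℂ (TorusPoly N)).compr₂ (vandermondeMean N)).compl₁₂
    (psumSubst N).toLinearMap (psumConjSubst N).toLinearMap

theorem psumPair_apply (f g : PsumPoly) :
    psumPair N f g = vandermondeMean N (psumSubst N f * psumConjSubst N g) := rfl

/-- The derivation `∑ⱼ j p_{j+k} ∂/∂p_j`. -/
def raise (k : ℕ) : Derivation ℂ PsumPoly PsumPoly :=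
  mkDerivation ℂ fun j => (j : ℂ) • X (j + k)

/-- The derivation `∑_{l > k} l p_{l-k} ∂/∂p_l`. -/
def lower (k : ℕ) : Derivation ℂ PsumPoly PsumPoly :=
  mkDerivation ℂ fun l => if k < l then (l : ℂ) • X (l - k) else 0

theorem shiftDeriv_psum (k j : ℕ) :
    shiftDeriv k (psum j : TorusPoly N) = (j : ℂ) • psum (j + k) := by
  rw [psum, psum, map_sum, Finset.smul_sum]
  refine Finset.sum_congr rfl fun n _ => ?_
  have h := derivation_pow_eigen (shiftDeriv k) (RingHom.id _) (X (Sum.inl n))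
    ((X (Sum.inl n) : TorusPoly N) ^ k) (by simp [shiftDeriv, mkDerivation_X, pow_succ]) j
  simp only [RingHom.id_apply] at h
  rw [h, smul_eq_C_mul, map_natCast]
  ring

theorem shiftDeriv_psumConj (k l : ℕ) : shiftDeriv k (psumConj l : TorusPoly N)
      = -((l : ℂ) • ∑ n, X (Sum.inl n) ^ k * X (Sum.inr n) ^ l) := by
  rw [psumConj, map_sum, Finset.smul_sum, ← Finset.sum_neg_distrib]
  refine Finset.sum_congr rfl fun n _ => ?_
  have h := derivation_pow_eigen (shiftDeriv k) (RingHom.id _) (X (Sum.inr n))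
    (-(X (Sum.inl n) : TorusPoly N) ^ k) (by simp [shiftDeriv, mkDerivation_X]) l
  simp only [RingHom.id_apply] at h
  rw [h, smul_eq_C_mul, map_natCast]
  ring

theorem shiftDeriv_psumSubst (k : ℕ) (f : PsumPoly) :
    shiftDeriv k (psumSubst N f) = psumSubst N (raise k f) := by
  induction f using MvPolynomial.induction_on with
  | C a => simp [psumSubst, derivation_C]
  | add p q hp hq => simp only [map_add, hp, hq]
  | mul_X p i hp =>
    rw [map_mul, Derivation.leibniz, hp, psumSubst_X, shiftDeriv_psum, Derivation.leibniz, raise,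
      mkDerivation_X]
    simp

variable {N}

theorem conj_pow_mul_pow {z : ℂ} (h : ‖z‖ = 1) {k l : ℕ} (hkl : k ≤ l) :
    z ^ k * (starRingEnd ℂ) z ^ l = (starRingEnd ℂ) z ^ (l - k) := by
  obtain ⟨m, rfl⟩ := Nat.exists_eq_add_of_le hkl
  rw [Nat.add_sub_cancel_left, pow_add, ← mul_assoc, ← mul_pow, mul_comm z, conj_mul_self h,
    one_pow, one_mul]

theorem pow_mul_conj_pow {z : ℂ} (h : ‖z‖ = 1) {k l : ℕ} (hkl : l ≤ k) :
    z ^ k * (starRingEnd ℂ) z ^ l = z ^ (k - l) := by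
  obtain ⟨m, rfl⟩ := Nat.exists_eq_add_of_le hkl
  rw [Nat.add_sub_cancel_left, pow_add, mul_right_comm, ← mul_pow, mul_comm z, conj_mul_self h,
    one_pow, one_mul]

theorem evTorus_shiftDeriv_psumConj (k l : ℕ) {x : Fin N → ℂ} (hx : ∀ n, ‖x n‖ = 1) :
    evTorus x (shiftDeriv k (psumConj l))
      = -(if k < l then l * evTorus x (psumConj (l - k)) else l * evTorus x (psum (k - l))) := by
  rw [shiftDeriv_psumConj]
  simp only [map_neg, map_smul, map_sum, map_mul, map_pow, evTorus_inl, evTorus_inr, smul_eq_mul,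
    psum, psumConj]
  split_ifs with h
  · simp_rw [fun n => conj_pow_mul_pow (hx n) h.le]
  · simp_rw [fun n => pow_mul_conj_pow (hx n) (not_lt.1 h)]

/-- On the torus `x^k x^(-l)` is an inverse power if `l > k`, which gives `lower`, and a nonnegative
power if `l ≤ k`, which gives the `pderiv` terms. The index `l = 0` has coefficient zero. -/
theorem evTorus_shiftDeriv_psumConjSubst (k : ℕ) {x : Fin N → ℂ} (hx : ∀ n, ‖x n‖ = 1)
    (g : PsumPoly) :
    evTorus x (shiftDeriv k (psumConjSubst N g))
      = -(∑ l ∈ Finset.Icc 1 k, l * (evTorus x (psum (k - l)) *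
          evTorus x (psumConjSubst N (pderiv l g)))
        + evTorus x (psumConjSubst N (lower k g))) := by
  induction g using MvPolynomial.induction_on with
  | C a => simp [psumConjSubst, derivation_C]
  | add p q hp hq =>
    simp only [map_add, hp, hq, mul_add, Finset.sum_add_distrib]
    ring
  | mul_X p i hp =>
    have h1 : ∀ l, evTorus x (psumConjSubst N (pderiv l (p * X i)))
        = evTorus x (psumConj i) * evTorus x (psumConjSubst N (pderiv l p))
          + if l = i then evTorus x (psumConjSubst N p) else 0 := by
      intro l
      rw [Derivation.leibniz, pderiv_X]
      by_cases hli : l = i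
      · subst hli
        simp [add_comm]
      · simp [hli, Ne.symm hli]
    rw [map_mul, Derivation.leibniz, psumConjSubst_X, map_add, smul_eq_mul, smul_eq_mul, map_mul,
      map_mul, hp, evTorus_shiftDeriv_psumConj k i hx]
    simp only [h1, mul_add, Finset.sum_add_distrib]
    have h2 : ∑ l ∈ Finset.Icc 1 k, (l : ℂ) * (evTorus x (psum (k - l)) *
          if l = i then evTorus x (psumConjSubst N p) else 0)
        = if k < i then 0 else i * (evTorus x (psum (k - i)) * evTorus x (psumConjSubst N p)) := by
      have h3 : ∀ l ∈ Finset.Icc 1 k, (l : ℂ) * (evTorus x (psum (k - l)) *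
          if l = i then evTorus x (psumConjSubst N p) else 0)
          = if l = i then (i : ℂ) * (evTorus x (psum (k - i)) * evTorus x (psumConjSubst N p))
            else 0 := fun l _ => by
        split_ifs with h
        · rw [h]
        · simp
      rw [Finset.sum_congr rfl h3, Finset.sum_ite_eq']
      rcases Nat.eq_zero_or_pos i with rfl | hi
      · simp
      · simp only [Finset.mem_Icc, Nat.succ_le_of_lt hi, true_and]
        split_ifs <;> first | rfl | omega
    have h4 : evTorus x (psumConjSubst N (lower k (p * X i)))
        = evTorus x (psumConj i) * evTorus x (psumConjSubst N (lower k p))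
          + if k < i then i * (evTorus x (psumConj (i - k)) * evTorus x (psumConjSubst N p))
            else 0 := by
      rw [Derivation.leibniz, lower, mkDerivation_X, map_add, map_add, smul_eq_mul, smul_eq_mul]
      split_ifs
      · simp only [map_mul, map_smul, psumConjSubst_X, smul_eq_mul]
        ring
      · simp
    have h5 : ∑ l ∈ Finset.Icc 1 k, (l : ℂ) * (evTorus x (psum (k - l)) *
          (evTorus x (psumConj i) * evTorus x (psumConjSubst N (pderiv l p))))
        = evTorus x (psumConj i) * ∑ l ∈ Finset.Icc 1 k, (l : ℂ) * (evTorus x (psum (k - l)) *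
          evTorus x (psumConjSubst N (pderiv l p))) := by
      rw [Finset.mul_sum]
      exact Finset.sum_congr rfl fun l _ => by ring
    rw [h2, h4, h5]
    split_ifs <;> ring

/-- The loop equations as a relation between pairings. -/
theorem psumPair_loop (k : ℕ) (f g : PsumPoly) :
    ∑ a ∈ Finset.range k, psumPair N (X a * (X (k - a) * f)) g + psumPair N (raise k f) g
      = ∑ l ∈ Finset.Icc 1 k, l * psumPair N (X (k - l) * f) (pderiv l g)
        + psumPair N f (lower k g) := by
  have h := vandermondeMean_loop k (psumSubst N f * psumConjSubst N g)
  rw [Derivation.leibniz, smul_eq_mul, smul_eq_mul, shiftDeriv_psumSubst] at h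
  have h1 : vandermondeMean N (psumSubst N f * shiftDeriv k (psumConjSubst N g))
      = -(∑ l ∈ Finset.Icc 1 k, l * psumPair N (X (k - l) * f) (pderiv l g)
        + psumPair N f (lower k g)) := by
    have h2 : ∑ l ∈ Finset.Icc 1 k, l * psumPair N (X (k - l) * f) (pderiv l g)
        + psumPair N f (lower k g) = vandermondeMean N (∑ l ∈ Finset.Icc 1 k,
          (l : ℂ) • (psum (k - l) * psumSubst N f * psumConjSubst N (pderiv l g))
            + psumSubst N f * psumConjSubst N (lower k g)) := by
      simp only [map_add, map_sum, map_smul, psumPair_apply, map_mul, psumSubst_X, smul_eq_mul]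
    rw [h2, ← map_neg]
    refine vandermondeMean_congr fun x hx => ?_
    simp only [map_mul, evTorus_shiftDeriv_psumConjSubst k hx g, map_neg, map_add, map_sum,
      map_smul, smul_eq_mul]
    rw [mul_neg, mul_add, Finset.mul_sum]
    congr 2
    exact Finset.sum_congr rfl fun l _ => by ring
  have h3 : ∑ a ∈ Finset.range k, psumPair N (X a * (X (k - a) * f)) g
      = vandermondeMean N ((∑ a ∈ Finset.range k, psum a * psum (k - a))
          * (psumSubst N f * psumConjSubst N g)) := by
    rw [Finset.sum_mul, map_sum]
    refine Finset.sum_congr rfl fun a _ => ?_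
    rw [psumPair_apply, map_mul (psumSubst N), map_mul (psumSubst N), psumSubst_X, psumSubst_X]
    exact congrArg (vandermondeMean N) (by ring)
  have h4 : psumPair N (raise k f) g
      = vandermondeMean N (psumConjSubst N g * psumSubst N (raise k f)) := by
    rw [psumPair_apply, mul_comm]
  rw [map_add, map_add, h1] at h
  rw [h3, h4]
  linear_combination h

theorem psumPair_X_zero_mul (f g : PsumPoly) :
    psumPair N (X 0 * f) g = N * psumPair N f g := by
  rw [psumPair_apply, psumPair_apply, map_mul (psumSubst N), psumSubst_X, mul_assoc,
    show (psum 0 : TorusPoly N) = C (N : ℂ) by simp [psum], ← smul_eq_C_mul, map_smul, smul_eq_mul]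

/-- The failure of `X k` and `k ∂/∂p_k` to be adjoint. -/
def adjointDefect (N k : ℕ) (f g : PsumPoly) : ℂ :=
  psumPair N (X k * f) g - k * psumPair N f (pderiv k g)

theorem adjointDefect_smul (k : ℕ) (c : ℂ) (f g : PsumPoly) :
    adjointDefect N k (c • f) g = c * adjointDefect N k f g := by
  simp only [adjointDefect, mul_smul_comm, map_smul, LinearMap.smul_apply, smul_eq_mul]
  ring

/-- Since `p_0 = N`, the terms `a = 0` on the left and `l = k` on the right of the loop equation
combine to `N` times the defect. The other indices pair up into defects of smaller `l` at the same
total degree. -/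
theorem adjointDefect_loop {k : ℕ} (hk : 1 ≤ k) (f g : PsumPoly) :
    N * adjointDefect N k f g
      + ∑ l ∈ Finset.Ico 1 k, adjointDefect N l (X (k - l) * f) g
      + (psumPair N (raise k f) g - psumPair N f (lower k g)) = 0 := by
  have h := psumPair_loop (N := N) k f g
  rw [Finset.range_eq_Ico, Finset.sum_eq_sum_Ico_succ_bot hk, Nat.sub_zero,
    psumPair_X_zero_mul, zero_add, ← Finset.Ico_add_one_right_eq_Icc,
    Finset.sum_Ico_succ_top hk, Nat.sub_self, psumPair_X_zero_mul] at h
  simp only [adjointDefect, Finset.sum_sub_distrib]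
  linear_combination h

/-- A commutator of derivations is a derivation, so it is determined by its values on the variables.
The assumption `1 ≤ b` puts `l = b + k` in the range `k < l` where `lower k` acts. -/
theorem pderiv_lower {b : ℕ} (hb : 1 ≤ b) (k : ℕ) (g : PsumPoly) :
    pderiv b (lower k g) = lower k (pderiv b g) + ((b + k : ℕ) : ℂ) • pderiv (b + k) g := by
  have h : ⁅(pderiv b : Derivation ℂ PsumPoly PsumPoly), lower k⁆
      = ((b + k : ℕ) : ℂ) • (pderiv (b + k) : Derivation ℂ PsumPoly PsumPoly) := by
    refine derivation_ext fun l => ?_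
    have h1 : lower k (pderiv (R := ℂ) b (X l)) = 0 := by
      rw [pderiv_X, Pi.single_apply]
      split_ifs <;> simp
    rw [Derivation.commutator_apply, h1, lower, mkDerivation_X, Derivation.smul_apply]
    by_cases hl : l = b + k
    · subst hl
      rw [if_pos (by omega), Nat.add_sub_cancel, Derivation.map_smul, pderiv_X_self, pderiv_X_self,
        sub_zero]
    · rw [pderiv_X_of_ne hl, smul_zero, sub_zero]
      split_ifs with hkl
      · rw [Derivation.map_smul, pderiv_X_of_ne (by omega), smul_zero]
      · exact map_zero _
  have h1 := DFunLike.congr_fun h g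
  rw [Derivation.commutator_apply, Derivation.smul_apply] at h1
  rw [← h1]
  ring

theorem pderiv_pderiv_comm (a b : ℕ) (g : PsumPoly) :
    pderiv a (pderiv b g) = pderiv b (pderiv a g) := by
  have h : ⁅(pderiv a : Derivation ℂ PsumPoly PsumPoly),
      (pderiv b : Derivation ℂ PsumPoly PsumPoly)⁆ = 0 := by
    refine derivation_ext fun l => ?_
    have h1 : ∀ a b : ℕ, pderiv (R := ℂ) a (pderiv (R := ℂ) b (X l)) = 0 := fun a b => by
      rw [pderiv_X, Pi.single_apply]
      split_ifs <;> simp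
    rw [Derivation.commutator_apply, h1, h1, sub_zero, Derivation.zero_apply]
  have h1 := DFunLike.congr_fun h g
  rwa [Derivation.commutator_apply, Derivation.zero_apply, sub_eq_zero] at h1

/-- Pairings of the constant `1` with polynomials of positive degree vanish. -/
theorem psumPair_one_euler (g : PsumPoly) : psumPair N 1 (lower 0 g) = 0 := by
  have h := psumPair_loop (N := N) 0 1 g
  simpa using h.symm

/-- `lower 0` is the Euler operator: monomials are eigenvectors with eigenvalue their degree, which
the factor `X l` makes nonzero. The vanishing expresses invariance under a common rotation of the
points. -/
theorem psumPair_one_X_mul {l : ℕ} (hl : 1 ≤ l) (g : PsumPoly) : psumPair N 1 (X l * g) = 0 := by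
  suffices h : ∀ s, psumPair N 1 (X l * monomial s 1) = 0 by
    induction g using MvPolynomial.induction_on' with
    | monomial s c =>
      rw [show monomial s c = c • (monomial s 1 : PsumPoly) by rw [smul_monomial, smul_eq_mul, mul_one],
        mul_smul_comm, map_smul, h, smul_zero]
    | add p q hp hq => rw [mul_add, map_add, hp, hq, add_zero]
  intro s
  obtain ⟨t, ht⟩ : ∃ t : ℕ →₀ ℕ, t = Finsupp.single l 1 + s := ⟨_, rfl⟩
  have h1 : X l * monomial s (1 : ℂ) = ∏ i ∈ insert l s.support, X i ^ t i := by
    rw [X, monomial_mul, one_mul, ← ht, monomial_eq, C_1, one_mul]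
    refine Finsupp.prod_of_support_subset _ ?_ _ fun _ _ => pow_zero _
    intro i hi
    rw [Finset.mem_insert, Finsupp.mem_support_iff]
    rw [Finsupp.mem_support_iff, ht, Finsupp.add_apply] at hi
    by_contra! hcon
    exact hi (by rw [hcon.2, Finsupp.single_eq_of_ne hcon.1, add_zero])
  have h2 := derivation_prod_eigen (lower 0) (RingHom.id _)
    (fun i => (X i : PsumPoly) ^ t i)
    (fun i => ((t i : ℕ) : PsumPoly) * (i : PsumPoly))
    (insert l s.support) fun i _ => derivation_pow_eigen _ (RingHom.id _) _ _ (by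
      rw [RingHom.id_apply, RingHom.id_apply, lower, mkDerivation_X, smul_eq_C_mul]
      rcases Nat.eq_zero_or_pos i with rfl | hi
      · simp
      · simp [hi]) _
  rw [← h1, RingHom.id_apply, RingHom.id_apply] at h2
  have h3 := psumPair_one_euler (N := N) (X l * monomial s (1 : ℂ))
  have h4 : (∑ i ∈ insert l s.support, ((t i : ℕ) : PsumPoly) * (i : PsumPoly))
      = C ((∑ i ∈ insert l s.support, t i * i : ℕ) : ℂ) := by
    push_cast
    simp
  rw [h2, h4, ← smul_eq_C_mul, map_smul, smul_eq_mul] at h3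
  refine (mul_eq_zero.1 h3).resolve_left ?_
  refine Nat.cast_ne_zero.2 ?_
  have h5 : t l * l
      ≤ ∑ i ∈ insert l s.support, t i * i :=
    Finset.single_le_sum (f := fun i => t i * i) (fun _ _ => Nat.zero_le _)
      (Finset.mem_insert_self l _)
  have h6 : 1 ≤ t l := by simp [ht]
  nlinarith

theorem psumPair_one_lower {k : ℕ} (g : PsumPoly) : psumPair N 1 (lower k g) = 0 := by
  -- The extra factor `f` lets the induction pass through the Leibniz rule.
  suffices h : ∀ f, psumPair N 1 (f * lower k g) = 0 by simpa using h 1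
  induction g using MvPolynomial.induction_on with
  | C a => simp [derivation_C]
  | add p q hp hq => intro f; rw [map_add, mul_add, map_add, hp, hq, add_zero]
  | mul_X p i hp =>
    intro f
    rw [Derivation.leibniz, mul_add, map_add, smul_eq_mul, smul_eq_mul, ← mul_assoc f (X i), hp,
      add_zero, lower, mkDerivation_X]
    split_ifs with h
    · rw [mul_smul_comm, mul_smul_comm, map_smul, ← mul_assoc, mul_comm _ (X (i - k)),
        psumPair_one_X_mul (by omega), smul_zero]
    · simp

end Pairing

/-! ### Adjointness up to degree `N` by a maximum argument, and Gaussian moments -/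

section Adjoint

variable {N : ℕ}

/-- The degree of `∏ᵢ p_i^{s_i}` as a polynomial in `x`. -/
abbrev psumDegree : (ℕ →₀ ℕ) →+ ℕ := Finsupp.weight (id : ℕ → ℕ)

theorem mul_le_psumDegree (s : ℕ →₀ ℕ) (a : ℕ) : s a * a ≤ psumDegree s := by
  rw [psumDegree, Finsupp.weight_apply, Finsupp.sum]
  by_cases h : s a = 0
  · simp [h]
  · exact Finset.single_le_sum (f := fun a => s a • id a) (fun _ _ => Nat.zero_le _)
      (Finsupp.mem_support_iff.2 h)

theorem support_subset_range {s : ℕ →₀ ℕ} {d : ℕ} (h : psumDegree s < d) :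
    s.support ⊆ Finset.range d := by
  intro a ha
  rw [Finsupp.mem_support_iff] at ha
  rw [Finset.mem_range]
  have := mul_le_psumDegree s a
  have : 1 * a ≤ s a * a := Nat.mul_le_mul_right a (Nat.one_le_iff_ne_zero.2 ha)
  omega

theorem psumDegree_eq_sum {s : ℕ →₀ ℕ} {d : ℕ} (h : psumDegree s < d) :
    psumDegree s = ∑ a ∈ Finset.range d, s a * a := by
  rw [psumDegree, Finsupp.weight_apply]
  exact Finsupp.sum_of_support_subset _ (support_subset_range h) _ fun _ _ => zero_mul _

theorem psumDegree_sub_single {s : ℕ →₀ ℕ} {a : ℕ} (h : s a ≠ 0) :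
    psumDegree (s - Finsupp.single a 1) + a = psumDegree s :=
  Finsupp.weight_sub_single_add (w := id) h

theorem pderiv_monomial_one (s : ℕ →₀ ℕ) (a : ℕ) : pderiv a (monomial s (1 : ℂ))
      = (s a : ℂ) • monomial (s - Finsupp.single a 1) (1 : ℂ) := by
  rw [pderiv_monomial, smul_monomial, smul_eq_mul, one_mul, mul_one]

theorem X_mul_monomial_one (s : ℕ →₀ ℕ) (a : ℕ) :
    X a * monomial s (1 : ℂ) = monomial (Finsupp.single a 1 + s) 1 := by
  rw [X, monomial_mul, one_mul]

theorem raise_monomial {s : ℕ →₀ ℕ} {d : ℕ} (h : psumDegree s < d) (k : ℕ) :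
    raise k (monomial s (1 : ℂ))
      = ∑ a ∈ Finset.range d, (a : ℂ) • (X (a + k) * pderiv a (monomial s (1 : ℂ))) := by
  rw [raise, mkDerivation_monomial, one_smul,
    Finsupp.sum_of_support_subset _ (support_subset_range h) _ (by simp)]
  refine Finset.sum_congr rfl fun a _ => ?_
  rw [pderiv_monomial_one]
  simp only [smul_monomial, smul_eq_mul, mul_one]
  rw [mul_smul_comm, mul_comm]

/-- The adjointness relation holds below total degree `d`. -/
def AdjointBelow (N d : ℕ) : Prop :=
  ∀ (k : ℕ) (s : ℕ →₀ ℕ), 1 ≤ k → s 0 = 0 → k + psumDegree s < d →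
    ∀ g, adjointDefect N k (monomial s 1) g = 0

theorem AdjointBelow.psumPair_eq {d : ℕ} (H : AdjointBelow N d) {k : ℕ} {s : ℕ →₀ ℕ} (hk : 1 ≤ k)
    (hs : s 0 = 0) (hd : k + psumDegree s < d) (g : PsumPoly) :
    psumPair N (X k * monomial s 1) g = k * psumPair N (monomial s 1) (pderiv k g) :=
  sub_eq_zero.1 (H k s hk hs hd g)

/-- Adjointness moves one variable `p_b` of the monomial across as `b ∂_b`. Commuting `∂_b` past
`lower k` produces the term `a = b`, and induction on the degree handles the rest. -/
theorem AdjointBelow.psumPair_lower {d : ℕ} (H : AdjointBelow N d) {k : ℕ}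
    (s : ℕ →₀ ℕ) (hs : s 0 = 0) (hd : psumDegree s < d) (g : PsumPoly) :
    psumPair N (monomial s 1) (lower k g) = ∑ a ∈ Finset.range d,
      (a : ℂ) * ((a + k : ℕ) : ℂ) *
        psumPair N (pderiv a (monomial s 1)) (pderiv (a + k) g) := by
  induction hw : psumDegree s using Nat.strong_induction_on generalizing s g with
  | _ w ih =>
  by_cases h0 : s = 0
  · subst h0
    simp [psumPair_one_lower, ← C_apply, -map_one]
  obtain ⟨b, hb⟩ := Finsupp.ne_iff.1 h0
  rw [Finsupp.zero_apply] at hb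
  have hb1 : 1 ≤ b := by
    rcases Nat.eq_zero_or_pos b with rfl | h
    · exact absurd hs hb
    · exact h
  obtain ⟨t, ht⟩ : ∃ t, t = s - Finsupp.single b 1 := ⟨_, rfl⟩
  have hdeg := psumDegree_sub_single hb
  rw [← ht] at hdeg
  have hst : s = Finsupp.single b 1 + t := by
    rw [ht, add_tsub_cancel_of_le]
    rw [Finsupp.single_le_iff]
    omega
  have ht0 : t 0 = 0 := by simp [ht, hs]
  have hbd : b < d := by omega
  have hmul : ∀ a h, psumPair N (X b * pderiv a (monomial t 1)) h
      = b * psumPair N (pderiv a (monomial t 1)) (pderiv b h) := by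
    intro a h
    rw [pderiv_monomial_one, mul_smul_comm, map_smul, map_smul, LinearMap.smul_apply,
      LinearMap.smul_apply, smul_eq_mul, smul_eq_mul]
    by_cases hta : t a = 0
    · simp [hta]
    · have := psumDegree_sub_single hta
      rw [H.psumPair_eq hb1 (by simp [ht0]) (by omega)]
      ring
  have hterm : ∀ a, psumPair N (pderiv a (monomial s 1)) (pderiv (a + k) g)
      = b * psumPair N (pderiv a (monomial t 1)) (pderiv (a + k) (pderiv b g))
        + if a = b then psumPair N (monomial t 1) (pderiv (b + k) g) else 0 := by
    intro a
    rw [hst, ← X_mul_monomial_one, Derivation.leibniz, map_add, LinearMap.add_apply, smul_eq_mul,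
      smul_eq_mul, hmul, pderiv_pderiv_comm b]
    congr 1
    split_ifs with hab
    · subst hab
      rw [pderiv_X_self, mul_one]
    · rw [pderiv_X_of_ne (Ne.symm hab), mul_zero, map_zero, LinearMap.zero_apply]
  rw [hst, ← X_mul_monomial_one, H.psumPair_eq hb1 ht0 (by omega), pderiv_lower hb1, map_add,
    map_smul, smul_eq_mul, ih (psumDegree t) (by omega) t ht0 (by omega) (pderiv b g) rfl,
    X_mul_monomial_one, ← hst]
  simp only [hterm, mul_add, Finset.sum_add_distrib, mul_ite, mul_zero, Finset.sum_ite_eq',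
    Finset.mem_range, hbd, if_true, Finset.mul_sum]
  congr 1
  · exact Finset.sum_congr rfl fun a _ => by ring
  · ring

theorem finite_setOf_psumDegree (d : ℕ) :
    {q : ℕ × (ℕ →₀ ℕ) | 1 ≤ q.1 ∧ q.2 0 = 0 ∧ q.1 + psumDegree q.2 = d}.Finite := by
  refine (((Set.finite_Iic d).prod (Set.finite_Iic
    (∑ i ∈ Finset.range (d + 1), Finsupp.single i d)))).subset ?_
  rintro ⟨k, s⟩ ⟨hk, hs, hd⟩
  simp only at hk hs hd
  refine ⟨by simp only [Set.mem_Iic]; omega, fun a => ?_⟩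
  have h1 := mul_le_psumDegree s a
  rw [Finsupp.finsetSum_apply]
  simp only [Finsupp.single_apply, Finset.sum_ite_eq', Finset.mem_range]
  rcases Nat.eq_zero_or_pos a with rfl | ha
  · simp [hs]
  · have h2 : s a ≤ s a * a := Nat.le_mul_of_pos_right _ ha
    split_ifs with h
    · omega
    · by_contra! hcon
      have : a ≤ s a * a := Nat.le_mul_of_pos_left _ hcon
      omega

/-- Shows that the remaining part of the loop equation is also a combination of defects, of the same
total degree as the leading one, so that the equation closes within each degree. -/
theorem psumPair_raise_sub_lower {d : ℕ} (H : AdjointBelow N d) {t : ℕ →₀ ℕ} (ht : t 0 = 0)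
    (htd : psumDegree t < d) (l : ℕ) (g : PsumPoly) :
    psumPair N (raise l (monomial t 1)) g - psumPair N (monomial t 1) (lower l g)
      = ∑ a ∈ Finset.range d, (a : ℂ) * adjointDefect N (a + l) (pderiv a (monomial t 1)) g := by
  rw [raise_monomial htd, H.psumPair_lower t ht htd, map_sum, LinearMap.sum_apply,
    ← Finset.sum_sub_distrib]
  refine Finset.sum_congr rfl fun a _ => ?_
  rw [map_smul, LinearMap.smul_apply, smul_eq_mul, adjointDefect]
  ring

/-- In the loop equation the coefficients other than `N` sum to `l - 1` from the quadratic part and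
`∑ a · t a`, the degree of `t`, from `raise` and `lower`: `d - 1` in total. -/
theorem norm_adjointDefect_le {l d : ℕ} {t : ℕ →₀ ℕ} {g : PsumPoly} {B : ℝ}
    (H : AdjointBelow N d) (hl : 1 ≤ l) (ht : t 0 = 0) (hlt : l + psumDegree t = d)
    (hbound : ∀ k s, 1 ≤ k → s 0 = 0 → k + psumDegree s = d →
      ‖adjointDefect N k (monomial s 1) g‖ ≤ B) :
    N * ‖adjointDefect N l (monomial t 1) g‖ ≤ (l - 1 : ℕ) * B + psumDegree t * B := by
  have htd : psumDegree t < d := by omega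
  have hloop := adjointDefect_loop (N := N) hl (monomial t 1) g
  have h1 : ‖∑ j ∈ Finset.Ico 1 l, adjointDefect N j (X (l - j) * monomial t 1) g‖
      ≤ (l - 1 : ℕ) * B := by
    refine (norm_sum_le_of_le _ (f := fun j => adjointDefect N j (X (l - j) * monomial t 1) g)
      (n := fun _ => B) fun j hj => ?_).trans (by simp)
    rw [Finset.mem_Ico] at hj
    rw [X_mul_monomial_one]
    refine hbound j _ hj.1 ?_ ?_
    · rw [Finsupp.add_apply, ht, Finsupp.single_eq_of_ne (by omega)]
    · rw [map_add, psumDegree, Finsupp.weight_single]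
      simp only [id, smul_eq_mul, one_mul]
      change j + (l - j + psumDegree t) = d
      omega
  have h2 : ‖∑ a ∈ Finset.range d,
      (a : ℂ) * adjointDefect N (a + l) (pderiv a (monomial t 1)) g‖ ≤ psumDegree t * B := by
    rw [psumDegree_eq_sum htd, Nat.cast_sum, Finset.sum_mul]
    refine norm_sum_le_of_le _ fun a _ => ?_
    rw [pderiv_monomial_one, adjointDefect_smul, norm_mul, norm_mul, Complex.norm_natCast,
      Complex.norm_natCast, ← mul_assoc, Nat.cast_mul, mul_comm (a : ℝ)]
    by_cases hta : t a = 0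
    · simp [hta]
    · have := psumDegree_sub_single hta
      gcongr
      exact hbound _ _ (by omega) (by simp [ht]) (by omega)
  rw [psumPair_raise_sub_lower H ht htd] at hloop
  rw [← Complex.norm_natCast, ← norm_mul, ← norm_neg]
  refine le_trans (le_of_eq ?_) ((norm_add_le _ _).trans (add_le_add h1 h2))
  exact congrArg _ (by linear_combination -hloop)

/-- Diagonal dominance: for fixed `g`, take the largest among the finitely many defects of degree
`d`. It satisfies `N B ≤ (d - 1) B` with `d ≤ N`, so `B = 0`. -/
theorem adjointBelow_succ {d : ℕ} (hd : d ≤ N) (H : AdjointBelow N d) : AdjointBelow N (d + 1) := by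
  intro k s hk hs hks g
  rcases Nat.lt_succ_iff_lt_or_eq.1 hks with hlt | heq
  · exact H k s hk hs hlt g
  obtain ⟨⟨l, t⟩, ⟨hl, ht, hlt⟩, hmax⟩ := Set.exists_max_image _
    (fun q : ℕ × (ℕ →₀ ℕ) => ‖adjointDefect N q.1 (monomial q.2 1) g‖) (finite_setOf_psumDegree d)
    ⟨(k, s), hk, hs, heq⟩
  have hbound : ∀ k s, 1 ≤ k → s 0 = 0 → k + psumDegree s = d →
      ‖adjointDefect N k (monomial s 1) g‖ ≤ ‖adjointDefect N l (monomial t 1) g‖ :=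
    fun k s h1 h2 h3 => hmax (k, s) ⟨h1, h2, h3⟩
  have h3 := norm_adjointDefect_le H hl ht hlt hbound
  have h4 : ((l - 1 : ℕ) : ℝ) + (psumDegree t : ℕ) + 1 ≤ N := by
    have : l - 1 + psumDegree t + 1 ≤ N := by simp only at hl hlt; omega
    exact_mod_cast this
  have h5 := norm_nonneg (adjointDefect N l (monomial t 1) g)
  have h6 := hbound k s hk hs heq
  exact norm_le_zero_iff.1 (by nlinarith)

theorem adjointBelow_of_le {d : ℕ} (hd : d ≤ N + 1) : AdjointBelow N d := by
  induction d with
  | zero => intro k s hk hs h; omega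
  | succ d ih => exact adjointBelow_succ (by omega) (ih (by omega))

/-- The polynomials in the `p_k`, `k ≥ 1`, of degree at most `n`. -/
def psumFiltration (n : ℕ) : Submodule ℂ PsumPoly :=
  Submodule.span ℂ {f | ∃ s : ℕ →₀ ℕ, s 0 = 0 ∧ psumDegree s ≤ n ∧ f = monomial s 1}

theorem one_mem_psumFiltration : (1 : PsumPoly) ∈ psumFiltration 0 :=
  Submodule.subset_span ⟨0, rfl, by simp, rfl⟩

theorem X_mul_mem_psumFiltration {n k K : ℕ} (hk : 1 ≤ k) (hK : k ≤ K) {f : PsumPoly}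
    (hf : f ∈ psumFiltration n) : X k * f ∈ psumFiltration (n + K) := by
  induction hf using Submodule.span_induction with
  | mem f hf =>
    obtain ⟨s, hs, hn, rfl⟩ := hf
    refine Submodule.subset_span ⟨Finsupp.single k 1 + s, ?_, ?_, X_mul_monomial_one s k⟩
    · rw [Finsupp.add_apply, hs, Finsupp.single_eq_of_ne (by omega)]
    · rw [map_add, psumDegree, Finsupp.weight_single]
      simp only [id, smul_eq_mul, one_mul]
      change k + psumDegree s ≤ n + K
      omega
  | zero => rw [mul_zero]; exact Submodule.zero_mem _
  | add f g _ _ hf hg => rw [mul_add]; exact Submodule.add_mem _ hf hg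
  | smul c f _ hf => rw [mul_smul_comm]; exact Submodule.smul_mem _ _ hf

/-- Multiplication by `p_k` and `k ∂/∂p_k` are adjoint in degree at most `N`. -/
theorem psumPair_X_mul {n k : ℕ} (hk : 1 ≤ k) (hn : n + k ≤ N) {f : PsumPoly}
    (hf : f ∈ psumFiltration n) (g : PsumPoly) :
    psumPair N (X k * f) g = k * psumPair N f (pderiv k g) := by
  induction hf using Submodule.span_induction with
  | mem f hf =>
    obtain ⟨s, hs, hsn, rfl⟩ := hf
    exact (adjointBelow_of_le le_rfl).psumPair_eq hk hs (by omega) g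
  | zero => simp
  | add f g _ _ hf hg =>
    rw [mul_add, map_add, map_add, LinearMap.add_apply, LinearMap.add_apply, hf, hg, mul_add]
  | smul c f _ hf =>
    rw [mul_smul_comm, map_smul, map_smul, LinearMap.smul_apply, LinearMap.smul_apply, hf,
      smul_eq_mul, smul_eq_mul]
    ring

/-- The linear form `∑_{1 ≤ k ≤ K} h_k k^{-1/2} p_k`. -/
def linearPsum (K : ℕ) (h : ℕ → ℂ) : PsumPoly :=
  ∑ k ∈ Finset.Icc 1 K, (h k * ((1 / Real.sqrt k : ℝ) : ℂ)) • X k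

theorem linearPsum_mul_mem (K : ℕ) (h : ℕ → ℂ) {n : ℕ} {f : PsumPoly}
    (hf : f ∈ psumFiltration n) : linearPsum K h * f ∈ psumFiltration (n + K) := by
  rw [linearPsum, Finset.sum_mul]
  refine Submodule.sum_mem _ fun k hk => ?_
  rw [Finset.mem_Icc] at hk
  rw [smul_mul_assoc]
  exact Submodule.smul_mem _ _ (X_mul_mem_psumFiltration hk.1 hk.2 hf)

theorem linearPsum_pow_mem (K : ℕ) (h : ℕ → ℂ) (j : ℕ) :
    linearPsum K h ^ j ∈ psumFiltration (j * K) := by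
  induction j with
  | zero => simpa using one_mem_psumFiltration
  | succ j ih =>
    rw [pow_succ', Nat.succ_mul]
    exact linearPsum_mul_mem K h ih

theorem pderiv_linearPsum (K : ℕ) (b : ℕ → ℂ) (k : ℕ) :
    pderiv k (linearPsum K b)
      = C (if k ∈ Finset.Icc 1 K then b k * ((1 / Real.sqrt k : ℝ) : ℂ) else 0) := by
  rw [linearPsum, map_sum]
  simp only [Derivation.map_smul, pderiv_X, Pi.single_apply]
  have : ∀ j ∈ Finset.Icc 1 K, (b j * ((1 / Real.sqrt j : ℝ) : ℂ)) • (if j = k then (1 : PsumPoly) else 0)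
      = if j = k then C (b k * ((1 / Real.sqrt k : ℝ) : ℂ)) else 0 := fun j _ => by
    split_ifs with hjk
    · rw [hjk, smul_eq_C_mul, mul_one]
    · rw [smul_zero]
  rw [Finset.sum_congr rfl this, Finset.sum_ite_eq']
  split_ifs <;> simp

theorem psumPair_linearPsum_mul {n K : ℕ} (hn : n + K ≤ N) (K' : ℕ) (hK : K ≤ K') (h b : ℕ → ℂ)
    {f : PsumPoly} (hf : f ∈ psumFiltration n) (s : ℕ) :
    psumPair N (linearPsum K h * f) (linearPsum K' b ^ s)
      = s * (∑ k ∈ Finset.Icc 1 K, h k * b k) * psumPair N f (linearPsum K' b ^ (s - 1)) := by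
  rw [linearPsum, Finset.sum_mul, map_sum, LinearMap.sum_apply, Finset.mul_sum, Finset.sum_mul]
  refine Finset.sum_congr rfl fun k hk => ?_
  have hk' := Finset.mem_Icc.1 hk
  rw [smul_mul_assoc, map_smul, LinearMap.smul_apply, smul_eq_mul,
    psumPair_X_mul hk'.1 (by omega) hf, Derivation.leibniz_pow, pderiv_linearPsum,
    if_pos (Finset.mem_Icc.2 ⟨hk'.1, by omega⟩), smul_eq_mul, mul_comm _ (C _), ← smul_eq_C_mul,
    ← Nat.cast_smul_eq_nsmul ℂ, map_smul, map_smul, smul_eq_mul, smul_eq_mul]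
  have hsq : ((1 / Real.sqrt k : ℝ) : ℂ) * ((1 / Real.sqrt k : ℝ) : ℂ) * k = 1 := by
    have h0 : (0 : ℝ) < k := by exact_mod_cast hk'.1
    have h1 : 1 / Real.sqrt k * (1 / Real.sqrt k) * k = 1 := by
      field_simp
      rw [Real.sq_sqrt h0.le]
    exact_mod_cast congrArg (fun r : ℝ => (r : ℂ)) h1
  linear_combination (s * h k * b k * psumPair N f (linearPsum K' b ^ (s - 1))) * hsq

theorem psumPair_one_linearPsum_pow (K : ℕ) (b : ℕ → ℂ) (s : ℕ) :
    psumPair N 1 (linearPsum K b ^ (s + 1)) = 0 := by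
  rw [pow_succ', linearPsum, Finset.sum_mul, map_sum]
  refine Finset.sum_eq_zero fun k hk => ?_
  rw [smul_mul_assoc, map_smul, psumPair_one_X_mul (Finset.mem_Icc.1 hk).1, smul_zero]

/-- Linear statistics `∑ₖ h_k p_k(x)` behave as jointly Gaussian variables up to degree `N`. -/
theorem psumPair_linearPsum_pow {K K' : ℕ} (hK : K ≤ K') (h b : ℕ → ℂ) (j s : ℕ) (hj : j * K ≤ N) :
    psumPair N (linearPsum K h ^ j) (linearPsum K' b ^ s)
      = if j = s then s.factorial * (∑ k ∈ Finset.Icc 1 K, h k * b k) ^ s else 0 := by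
  induction j generalizing s with
  | zero =>
    rcases s with _ | s
    · simp [psumPair_apply, vandermondeMean_one]
    · rw [pow_zero, psumPair_one_linearPsum_pow, if_neg (by omega)]
  | succ j ih =>
    rw [Nat.succ_mul] at hj
    rw [pow_succ', psumPair_linearPsum_mul hj K' hK h b (linearPsum_pow_mem K h j), ih _ (by omega)]
    rcases s with _ | s
    · simp
    · simp only [Nat.add_sub_cancel, Nat.add_right_cancel_iff]
      split_ifs with hjs
      · rw [Nat.factorial_succ, pow_succ]
        push_cast
        ring
      · rw [mul_zero]

end Adjoint

open Filter Topology

/-! ### The population loss -/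

section Expectation

variable {N : ℕ}

/-- Extension of a sequence indexed by positive integers by `0`. -/
def pnatExtend (f : ℕ+ → ℂ) (k : ℕ) : ℂ := if hk : 0 < k then f ⟨k, hk⟩ else 0

theorem sum_pnatExtend (f : ℕ+ → ℂ) (n : ℕ) :
    ∑ k ∈ Finset.Icc 1 n, pnatExtend f k = ∑ k ∈ Finset.range n, f k.succPNat := by
  rw [← Finset.Ico_add_one_right_eq_Icc, Finset.sum_Ico_eq_sum_range]
  refine Finset.sum_congr (by simp) fun k _ => ?_
  rw [pnatExtend, dif_pos (by omega)]
  congr 1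
  exact PNat.eq (by simp [add_comm])

theorem tendsto_sum_pnatExtend {f : ℕ+ → ℂ} (hf : Summable f) :
    Tendsto (fun n => ∑ k ∈ Finset.Icc 1 n, pnatExtend f k) atTop (𝓝 (∑' k, f k)) := by
  simp_rw [sum_pnatExtend]
  exact (Equiv.pnatEquivNat.symm.hasSum_iff.2 hf.hasSum).tendsto_sum_nat

theorem tsum_eq_sum_pnatExtend {f : ℕ+ → ℂ} {n : ℕ} (hf : ∀ k : ℕ+, n < (k : ℕ) → f k = 0) :
    ∑' k, f k = ∑ k ∈ Finset.Icc 1 n, pnatExtend f k := by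
  rw [sum_pnatExtend, ← Equiv.pnatEquivNat.symm.tsum_eq f]
  refine tsum_eq_sum fun k hk => hf _ ?_
  rw [Finset.mem_range] at hk
  change n < k + 1
  omega

theorem evTorus_linearPsum (n : ℕ) (b : ℕ+ → ℂ) (x : Fin N → ℂ) :
    evTorus x (psumSubst N (linearPsum n (pnatExtend b)))
      = ∑ k ∈ Finset.Icc 1 n, pnatExtend (fun k => b k * powerSum k x) k := by
  simp only [linearPsum, map_sum, map_smul, psumSubst_X, psum, map_pow, evTorus_inl, smul_eq_mul]
  refine Finset.sum_congr rfl fun k hk => ?_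
  have hk0 : 0 < k := (Finset.mem_Icc.1 hk).1
  simp only [pnatExtend, dif_pos hk0, powerSum, PNat.mk_coe]
  ring

theorem evTorus_linearPsum_conj (n : ℕ) (b : ℕ → ℂ) (x : Fin N → ℂ) :
    evTorus x (psumConjSubst N (linearPsum n fun k => (starRingEnd ℂ) (b k)))
      = (starRingEnd ℂ) (evTorus x (psumSubst N (linearPsum n b))) := by
  simp [linearPsum, psum, psumConj]

theorem pairing_eq_evTorus {h : Feature} {K : ℕ} (hh : ∀ k : ℕ+, K < (k : ℕ) → h k = 0)
    (x : Fin N → ℂ) :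
    pairing h x = evTorus x (psumSubst N (linearPsum K (pnatExtend fun k => h k))) := by
  rw [evTorus_linearPsum, pairing]
  exact tsum_eq_sum_pnatExtend fun k hk => by rw [hh k hk, zero_mul]

theorem sum_mul_conj_eq_inner {h b : Feature} {K : ℕ} (hh : ∀ k : ℕ+, K < (k : ℕ) → h k = 0) :
    ∑ k ∈ Finset.Icc 1 K, pnatExtend (fun k => h k) k
        * (starRingEnd ℂ) (pnatExtend (fun k => b k) k)
      = (starRingEnd ℂ) (inner ℂ h b) := by
  rw [lp.inner_eq_tsum, tsum_eq_sum_pnatExtend (n := K) fun k hk => by rw [hh k hk, inner_zero_left],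
    map_sum]
  refine Finset.sum_congr rfl fun k hk => ?_
  have hk0 : 0 < k := (Finset.mem_Icc.1 hk).1
  simp [pnatExtend, dif_pos hk0, mul_comm]

instance : IsFiniteMeasure (vandermondeMeasure N) := by
  refine isFiniteMeasure_withDensity_ofReal (Integrable.hasFiniteIntegral ?_)
  have h := integrable_torus (N := N) (f := fun x => (((1 / (N.factorial : ℝ)) *
    ∏ i : Fin N, ∏ j ∈ Finset.Ioi i, ‖x i - x j‖ ^ 2 : ℝ) : ℂ)) (by fun_prop)
  exact h.re

theorem ae_torus_vandermonde : ∀ᵐ x ∂vandermondeMeasure N, ∀ n, ‖x n‖ = 1 :=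
  (withDensity_absolutelyContinuous _ _).ae_le (ae_torus N)

theorem exists_bound_torus {f : (Fin N → ℂ) → ℂ} (hf : Continuous f) :
    ∃ C, ∀ x : Fin N → ℂ, (∀ n, ‖x n‖ = 1) → ‖f x‖ ≤ C := by
  obtain ⟨C, hC⟩ := (isCompact_closedBall (0 : Fin N → ℂ) 1).exists_bound_of_continuousOn
    hf.continuousOn
  refine ⟨C, fun x hx => hC x ?_⟩
  rw [mem_closedBall_zero_iff, pi_norm_le_iff_of_nonneg zero_le_one]
  exact fun n => (hx n).le

/-- The student's linear statistic is truncated at `n` so that both factors are polynomials. For `n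
≥ √N` the moment no longer depends on `n`, because `h` is supported on `k ≤ √N`; the summable bound
`u` allows dominated convergence. -/
theorem integrable_and_integral_link {h b : Feature} {u : ℕ+ → ℝ} (α : ℕ → ℂ) (s : ℕ)
    (hh : ∀ k : ℕ+, Nat.sqrt N < (k : ℕ) → h k = 0) (hu : Summable u)
    (hb : ∀ (x : Fin N → ℂ), (∀ n, ‖x n‖ = 1) → ∀ k, ‖b k * powerSum k x‖ ≤ u k) :
    Integrable (fun x : Fin N → ℂ => link N α (pairing h x) * (starRingEnd ℂ) (pairing b x) ^ s)
        (vandermondeMeasure N) ∧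
      ∫ x : Fin N → ℂ, link N α (pairing h x) * (starRingEnd ℂ) (pairing b x) ^ s
          ∂vandermondeMeasure N
        = ∑ j ∈ Finset.Icc 1 (Nat.sqrt N), α j / ((Real.sqrt (j.factorial) : ℝ) : ℂ) *
          if j = s then s.factorial * (starRingEnd ℂ) (inner ℂ h b) ^ s else 0 := by
  set K := Nat.sqrt N
  set H := linearPsum K (pnatExtend fun k => h k)
  set G : ℕ → PsumPoly := fun n => linearPsum n fun k => (starRingEnd ℂ) (pnatExtend (fun k => b k) k)
  set P : TorusPoly N :=
    ∑ j ∈ Finset.Icc 1 K, (α j / ((Real.sqrt (j.factorial) : ℝ) : ℂ)) • psumSubst N (H ^ j)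
  have hP : ∀ x : Fin N → ℂ, link N α (pairing h x) = evTorus x P := fun x => by
    simp only [P, link, pairing_eq_evTorus hh, map_sum, map_smul, map_pow, smul_eq_mul, H, K]
  set Φ : ℕ → (Fin N → ℂ) → ℂ := fun n x => evTorus x (P * psumConjSubst N (G n ^ s))
  have hΦ : ∀ n x, Φ n x = evTorus x P * (starRingEnd ℂ)
      (∑ k ∈ Finset.Icc 1 n, pnatExtend (fun k => b k * powerSum k x) k) ^ s := fun n x => by
    simp only [Φ, G, map_mul, map_pow, evTorus_linearPsum_conj, evTorus_linearPsum]
  have hmeas : ∀ n, AEStronglyMeasurable (Φ n) (vandermondeMeasure N) := fun n =>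
    (continuous_evTorus _).aestronglyMeasurable
  obtain ⟨C, hC⟩ := exists_bound_torus (continuous_evTorus P)
  have hu0 : ∀ k, 0 ≤ u k := fun k => (norm_nonneg _).trans (hb 1 (by simp) k)
  have hbound : ∀ n, ∀ᵐ x ∂vandermondeMeasure N, ‖Φ n x‖ ≤ C * (∑' k, u k) ^ s := fun n => by
    filter_upwards [ae_torus_vandermonde] with x hx
    rw [hΦ, norm_mul, norm_pow, RCLike.norm_conj]
    have h1 := hC x hx
    have h2 : ‖∑ k ∈ Finset.Icc 1 n, pnatExtend (fun k => b k * powerSum k x) k‖ ≤ ∑' k, u k := by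
      rw [sum_pnatExtend]
      refine (norm_sum_le_of_le _ fun k _ => hb x hx k.succPNat).trans ?_
      rw [← Equiv.pnatEquivNat.symm.tsum_eq u]
      exact (Equiv.pnatEquivNat.symm.summable_iff.2 hu).sum_le_tsum _ fun k _ => hu0 _
    have h3 := (norm_nonneg _).trans h1
    gcongr
  have hlim : ∀ᵐ x ∂vandermondeMeasure N, Tendsto (fun n => Φ n x) atTop
      (𝓝 (link N α (pairing h x) * (starRingEnd ℂ) (pairing b x) ^ s)) := by
    filter_upwards [ae_torus_vandermonde] with x hx
    simp only [hΦ, hP]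
    have h1 := tendsto_sum_pnatExtend
      (Summable.of_norm_bounded hu (f := fun k => b k * powerSum k x) (hb x hx))
    exact (((Complex.continuous_conj.tendsto _).comp h1).pow s).const_mul _
  have hmean : ∀ n, K ≤ n → ∫ x, Φ n x ∂vandermondeMeasure N
      = ∑ j ∈ Finset.Icc 1 K, α j / ((Real.sqrt (j.factorial) : ℝ) : ℂ) *
          if j = s then s.factorial * (starRingEnd ℂ) (inner ℂ h b) ^ s else 0 := by
    intro n hn
    simp only [Φ]
    rw [integral_evTorus, Finset.sum_mul, map_sum]
    refine Finset.sum_congr rfl fun j hj => ?_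
    rw [smul_mul_assoc, map_smul, smul_eq_mul, ← psumPair_apply, psumPair_linearPsum_pow hn,
      sum_mul_conj_eq_inner hh]
    exact (Nat.mul_le_mul_right K (Finset.mem_Icc.1 hj).2).trans (Nat.sqrt_le N)
  have hmeas' := aestronglyMeasurable_of_tendsto_ae atTop hmeas hlim
  refine ⟨Integrable.of_bound hmeas' (C * (∑' k, u k) ^ s) ?_, ?_⟩
  · filter_upwards [hlim, ae_all_iff.2 hbound] with x hx hx'
    exact le_of_tendsto hx.norm (Eventually.of_forall hx')
  · have h1 := tendsto_integral_of_dominated_convergence (fun _ => C * (∑' k, u k) ^ s) hmeas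
      (integrable_const _) hbound hlim
    refine tendsto_nhds_unique h1 (tendsto_const_nhds.congr' ?_)
    filter_upwards [eventually_ge_atTop K] with n hn using (hmean n hn).symm

/-- Unconditional convergence at `z = 1` is absolute convergence. -/
theorem Activation.summable_norm_coeff (σ : Activation) : Summable fun k => ‖σ.coeff k‖ := by
  have h := (σ.hasSum 1 (by simp)).summable
  simpa using h.norm

theorem norm_featureMap_mul_powerSum_le {M : ℕ} (σ : Activation) (a : Fin M → Circle)
    (w : EuclideanSpace ℂ (Fin M)) {x : Fin N → ℂ} (hx : ∀ n, ‖x n‖ = 1) (k : ℕ+) :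
    ‖featureMap σ a w k * powerSum k x‖ ≤ (∑ m, ‖w m‖) * N * ‖σ.coeff k‖ := by
  have h2 : (featureMap σ a w) k
      = ∑ m, w m * (σ.coeff k * ((Real.sqrt (k : ℕ) : ℝ) : ℂ) * (a m : ℂ) ^ (k : ℕ)) := by
    simp only [featureMap, _root_.sum_apply, lp.coeFn_sum]
    exact Finset.sum_apply k Finset.univ _
  have hk : (0 : ℝ) < Real.sqrt (k : ℕ) := Real.sqrt_pos.2 (by exact_mod_cast k.pos)
  have h3 : ‖featureMap σ a w k‖ ≤ (∑ m, ‖w m‖) * (‖σ.coeff k‖ * Real.sqrt (k : ℕ)) := by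
    rw [h2, Finset.sum_mul]
    refine norm_sum_le_of_le _ fun m _ => le_of_eq ?_
    have h0 : ‖(a m : ℂ)‖ = 1 := Circle.norm_coe (a m)
    simp [abs_of_pos hk, h0]
  have h4 : ‖powerSum k x‖ ≤ 1 / Real.sqrt (k : ℕ) * N := by
    rw [powerSum, norm_mul, Complex.norm_real, Real.norm_of_nonneg (by positivity)]
    gcongr
    refine (norm_sum_le_of_le _ fun n _ => (by rw [norm_pow, hx, one_pow] :
      ‖x n ^ (k : ℕ)‖ ≤ 1)).trans (by simp)
  calc ‖featureMap σ a w k * powerSum k x‖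
      ≤ (∑ m, ‖w m‖) * (‖σ.coeff k‖ * Real.sqrt (k : ℕ)) * (1 / Real.sqrt (k : ℕ) * N) := by
        rw [norm_mul]
        gcongr
    _ = _ := by field_simp

/-- The population loss depends on the weights only through the overlap and `‖A w‖`. -/
theorem loss_eq {M : ℕ} (σ : Activation) (a : Fin M → Circle) {α : ℕ → ℂ} {s : ℕ} {h : Feature}
    (hs : IsInfoExponent N α s) (hh : ∀ k : ℕ+, Nat.sqrt N < (k : ℕ) → h k = 0) :
    loss N σ a α s h = fun w => ‖α s‖ * reducedLoss σ a h s w := by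
  funext w
  have hα : ‖α s‖ ≠ 0 := norm_ne_zero_iff.2 hs.1.2
  obtain ⟨hint, hval⟩ := integrable_and_integral_link (N := N) (b := featureMap σ a w) α s hh
    (σ.summable_norm_coeff.mul_left ((∑ m, ‖w m‖) * N))
    fun x hx k => norm_featureMap_mul_powerSum_le σ a w hx k
  set c : ℂ := (starRingEnd ℂ) (α s / ((‖α s‖ * Real.sqrt (s.factorial) : ℝ) : ℂ)) with hc
  have h1 : ∫ x : Fin N → ℂ, -(teacher α h x * (starRingEnd ℂ) (student σ a α s w x)).re
      ∂(vandermondeMeasure N)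
      = -(c * ∫ x : Fin N → ℂ, link N α (pairing h x) *
        (starRingEnd ℂ) (pairing (featureMap σ a w) x) ^ s ∂vandermondeMeasure N).re := by
    rw [integral_neg, ← integral_const_mul]
    congr 1
    refine (integral_congr_ae ?_).trans (Complex.reCLM.integral_comp_comm (hint.const_mul c))
    filter_upwards [ae_torus_vandermonde] with x hx
    rw [student, sum_embedding_eq_pairing σ a w x hx, studentLink, teacher, map_mul, map_pow, ← hc,
      Complex.reCLM_apply]
    congr 1
    ring
  rw [loss, h1, hval, reducedLoss]
  have h2 : c * ∑ j ∈ Finset.Icc 1 (Nat.sqrt N), α j / ((Real.sqrt (j.factorial) : ℝ) : ℂ) *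
      (if j = s then s.factorial * (starRingEnd ℂ) (inner ℂ h (featureMap σ a w)) ^ s else 0)
      = ((‖α s‖ : ℝ) : ℂ) * (starRingEnd ℂ) (overlap σ a h w ^ s) := by
    simp only [mul_ite, mul_zero, Finset.sum_ite_eq', hs.1.1, if_true]
    rw [hc, map_div₀, Complex.conj_ofReal, map_pow, overlap]
    have h3 : (starRingEnd ℂ) (α s) * α s = ((‖α s‖ : ℝ) : ℂ) ^ 2 := Complex.conj_mul' _
    have h4 : ((Real.sqrt (s.factorial) : ℝ) : ℂ) ^ 2 = s.factorial := by
      rw [← Complex.ofReal_pow, Real.sq_sqrt (by positivity)]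
      simp
    have h5 : ((Real.sqrt (s.factorial) : ℝ) : ℂ) ≠ 0 := by
      rw [Complex.ofReal_ne_zero]
      have : (0 : ℝ) < s.factorial := by exact_mod_cast s.factorial_pos
      positivity
    have h6 : ((‖α s‖ : ℝ) : ℂ) ≠ 0 := Complex.ofReal_ne_zero.2 hα
    push_cast
    rw [← h4]
    field_simp
    linear_combination (starRingEnd ℂ) (inner ℂ h (featureMap σ a w)) ^ s * h3
  rw [h2, Complex.re_ofReal_mul, Complex.conj_re, pow_mul]
  ring

end Expectation

end DeepSets

end

/-! ### Assembly: from the reduced flow to the stated convergence time -/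

theorem theorem4p2 :
    ∃ c C : ℝ, 0 < c ∧ 0 < C ∧
      ∀ (N M : ℕ) (σ : DeepSets.Activation) (a : Fin M → Circle) (α : ℕ → ℂ) (s : ℕ)
        (h : DeepSets.Feature) (w : ℝ → EuclideanSpace ℂ (Fin M)) (ε : ℝ),
        DeepSets.IsInfoExponent N α s →
        ‖h‖ = 1 →
        (∀ k : ℕ+, Nat.sqrt N < (k : ℕ) → h k = 0) →
        (DeepSets.gram σ a).IsInvertible →
        DeepSets.IsPreconditionedFlow N σ a α s h w →
        0 < ε →
        0 < DeepSets.radius σ a h (w 0) →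
        DeepSets.radius σ a h (w 0) ≤ 1 →
        1 / 2 ≤ DeepSets.cosPhase σ a s h (w 0) →
        DeepSets.residual σ a h (w 0) = 1 - DeepSets.radius σ a h (w 0) ^ 2 →
        DeepSets.approxError σ a h ≤
          min (ε / 2) (c * ((s : ℝ) ^ s)⁻¹ * DeepSets.radius σ a h (w 0) ^ 4) →
        ∃ T : ℝ, 0 ≤ T ∧
          1 - ε ≤ DeepSets.radius σ a h (w T) ∧
          1 - ε ≤ DeepSets.cosPhase σ a s h (w T) ∧
          DeepSets.residual σ a h (w T) ≤ ε ∧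
          (s = 1 → T ≤ C * Real.posLog (1 / ε)) ∧
          (1 < s → T ≤ C * ((2 : ℝ) ^ (s ^ 2) * (DeepSets.radius σ a h (w 0) ^ (4 * s))⁻¹
            + Real.posLog (1 / ε))) := by
  refine ⟨1 / 4, 41000, by norm_num, by norm_num, ?_⟩
  intro N M σ a α s h w ε hs hh hsupp hg hw hε hr hr1 hc hv hδ
  have hs1 : 1 ≤ s := (Finset.mem_Icc.1 hs.1.1).1
  have hlog : 0 ≤ Real.posLog (1 / ε) := Real.posLog_nonneg
  -- For `ε ≥ 1` the initial point already satisfies the three targets, so `T = 0`.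
  rcases le_or_gt 1 ε with hε1 | hε1
  · refine ⟨0, le_rfl, by linarith, by linarith, ?_, fun _ => by positivity,
      fun _ => by positivity⟩
    rw [hv]
    linarith [sq_nonneg (DeepSets.radius σ a h (w 0))]
  have hlog1 : Real.posLog (1 / ε) = Real.log (1 / ε) :=
    Real.posLog_eq_log (by
      rw [abs_of_pos (by positivity), le_div_iff₀ hε]
      linarith)
  have F := DeepSets.reducedFlow hs1 hs.1.2 hh hg (DeepSets.loss_eq σ a hs hsupp) hw hr hc hv
  have hδε := hδ.trans (min_le_left _ _)
  have hδr := hδ.trans (min_le_right _ _)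
  suffices key : ∃ T : ℝ, (0 ≤ T ∧ (1 - ε) ^ 2 ≤ DeepSets.radius σ a h (w T) ^ 2 ∧
      (1 - ε) ^ 2 * (DeepSets.radius σ a h (w T) ^ 2) ^ s
        ≤ (DeepSets.overlap σ a h (w T) ^ s).re ^ 2 ∧
      ‖DeepSets.featureMap σ a (w T)‖ ^ 2 - DeepSets.radius σ a h (w T) ^ 2 ≤ ε) ∧
      (s = 1 → T ≤ 41000 * Real.log (1 / ε)) ∧
      (1 < s → T ≤ 41000 * ((2 : ℝ) ^ (s ^ 2) * (DeepSets.radius σ a h (w 0) ^ (4 * s))⁻¹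
            + Real.log (1 / ε))) by
    obtain ⟨T, ⟨hT0, h1, h2, h3⟩, h4, h5⟩ := key
    rw [hlog1]
    have hrT : 1 - ε ≤ DeepSets.radius σ a h (w T) :=
      abs_le_of_sq_le_sq' h1 (norm_nonneg _) |>.2
    have hpos : 0 < DeepSets.radius σ a h (w T) ^ s := pow_pos (by linarith) s
    refine ⟨T, hT0, hrT, ?_, ?_, h4, h5⟩
    · have hx := F.x_pos hT0
      rw [← pow_mul, mul_comm 2 s, pow_mul, ← mul_pow] at h2
      have h6 := abs_le_of_sq_le_sq' h2 hx.le |>.2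
      rw [← DeepSets.cosPhase_mul] at h6
      exact le_of_mul_le_mul_right h6 hpos
    · rwa [DeepSets.residual_eq hh]
  have hlogpos : 0 ≤ Real.log (1 / ε) := hlog1 ▸ hlog
  rcases hs1.eq_or_lt with rfl | hs2
  · refine ⟨_, F.target_of_eq_one rfl hε hε1 (by linarith) rfl, fun _ => by linarith,
      fun h => absurd h (lt_irrefl 1)⟩
  -- With `c = 1/4`, the bounds `s ≤ s^s` and `r₀ ≤ 1` reduce the second bound on `δ` to `δ ≤
  -- 1/(4s)`, which is all that the slow stage needs.
  · have hδs : 1 - (1 - DeepSets.approxError σ a h) ≤ 1 / (4 * s) := by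
      have h1 : (s : ℝ) ≤ (s : ℝ) ^ s := le_self_pow₀ (by exact_mod_cast hs1) (by omega)
      have h2 : (0 : ℝ) < s := by exact_mod_cast hs1
      have h3 : DeepSets.radius σ a h (w 0) ^ 4 ≤ 1 := pow_le_one₀ hr.le hr1
      calc 1 - (1 - DeepSets.approxError σ a h) = DeepSets.approxError σ a h := by ring
        _ ≤ 1 / 4 * ((s : ℝ) ^ s)⁻¹ * DeepSets.radius σ a h (w 0) ^ 4 := hδr
        _ ≤ 1 / 4 * (s : ℝ)⁻¹ * 1 := by gcongr
        _ = 1 / (4 * s) := by rw [mul_one, one_div, one_div, mul_inv]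
    refine ⟨_, F.target_of_two_le hs2 hε hε1 hδs (by linarith) rfl, fun h => by omega, fun _ => ?_⟩
    exact DeepSets.time_bound hs2 hr hr1 hε hε1
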